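/- **Proposition 3.2 (duality relation).** Let $T>0$, $\delta\ge 0$, let $(\Omega,\mathcal F,P)$ be a probability space carrying a $d$-dimensional Brownian motion $W$ on $[0,\infty)$, let $\mathbb F=(\mathcal F_t)$ be its natural filtration augmented by the $P$-null sets, with $\mathcal F_t:=\mathcal F_0$ for $t\le 0$, and write $E_t=E[\,\cdot\mid\mathcal F_t]$; a prime denotes the transpose (adjoint). *Data.* Let $\lambda_0,\lambda_1,\lambda_2,\lambda_3$ be probability measures on $[0,\delta]$, and let $\bar G(t,r),\bar B(t,r)\in\mathbb R^{n\times n}$, $\bar\Sigma(t,r)\in\mathcal L(\mathbb R^n;\mathbb R^{n\times d})$, $\bar L(t,r)\in\mathbb R^{1\times n}$ be random densities that are jointly measurable in $(t,\omega,r)$, adapted in $t\in[0,T]$, and such that $\int_0^\delta|\bar G(t,r)|\lambda_0(dr)$, $\int_0^\delta|\bar B(t,r)|\lambda_1(dr)$, $\int_0^\delta|\bar\Sigma(t,r)|\lambda_2(dr)$, $\int_0^\delta|\bar L(t,r)|\lambda_3(dr)$ are bounded uniformly in $(t,\omega)\in[0,T]\times\Omega$; put $\bar L(t,\cdot)=0$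 for $t>T$. Let $\bar b_u(t)\in\mathcal L(\mathbb R^m;\mathbb R^n)$ and $\bar\sigma_u(t)\in\mathcal L(\mathbb R^m;\mathbb R^{n\times d})$ be jointly measurable, adapted and bounded on $[0,T]$, and let $v\in L^2_{\mathbb F}(0,T;\mathbb R^m)$. Here $L^2_{\mathbb F}(a,b;H)$ is the space of measurable adapted processes $\theta$ with $E\int_a^b|\theta(t)|^2dt<\infty$. Let $$\rho(t)=\int_0^t\bar b_u(s)v(s)\,ds+\int_0^t\bar\sigma_u(s)v(s)\,dW(s),\qquad t\in[0,T]$$ (any jointly measurable version). *Forward equation.* Let $\chi\in L^2_{\mathbb F}(-\delta,T;\mathbb R^n)$, with $\chi=0$ on $[-\delta,0]$, solve for a.e. $t\in[0,T]$, a.s., $$\chi(t)-\int_0^\delta\bar G(t,r)\chi(t-r)\lambda_0(dr)=\int_0^t\Big[\int_0^\delta\bar B(s,r)\chi(s-r)\lambda_1(dr)+\bar b_u(s)v(s)\Big]ds+\int_0^t\Big[\int_0^\delta\bar\Sigma(s,r)\chi(s-r)\lambda_2(dr)+\bar\sigma_u(s)v(s)\Big]dW(s),\tag{3.2}$$ where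 the terms of the equation make sense, that is, $E\int_0^T\big(\int_0^\delta|A(t,r)\chi(t-r)|\lambda(dr)\big)^2dt<\infty$ for $(A,\lambda)=(\bar G,\lambda_0),(\bar B,\lambda_1),(\bar\Sigma,\lambda_2)$, and suppose that $$I(\chi)=E\int_0^T\int_0^\delta\bar L(t,r)\chi(t-r)\,\lambda_3(dr)\,dt$$ is well defined, that is, $E\int_0^T\int_0^\delta|\bar L(t,r)\chi(t-r)|\lambda_3(dr)dt<\infty$. (All of these integrability conditions hold automatically if $E\sup_{[-\delta,T]}|\chi|^2<\infty$, or if the densities are bounded.) *Backward equation.* Let $(Y,Z)\in\mathcal M^2(0,T+\delta)$: $Y\in L^2_{\mathbb F}(0,T+\delta;\mathbb R^n)$; $Z:[0,T+\delta]^2\times\Omega\to\mathbb R^{n\times d}$ is jointly measurable, $Z(t,\cdot)$ is $\mathbb F$-adapted for every $t$, $E\int_0^{T+\delta}\int_0^{T+\delta}|Z(t,s)|^2ds\,dt<\infty$; and $Y(t)=E[Y(t)]+\int_0^tZ(t,s)\,dW(s)$ for a.e. $t\in[0,T+\delta]$. Suppose that $(Y,Z)$ is an adapted M-solution of $$\begin{aligned}Y(t)-E_t\Big[\int_0^\delta\bar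 G'(t+r,r)Y(t+r)\lambda_0(dr)\Big]={}&\int_0^\delta\bar L'(t+r,r)\lambda_3(dr)+\int_t^TE_s\Big[\int_0^\delta\bar B'(t+r,r)Y(s+r)\lambda_1(dr)\\&+\int_0^\delta\bar\Sigma'(t+r,r)Z(s+r,t+r)\lambda_2(dr)\Big]ds-\int_t^TZ(t,s)\,dW(s),\quad t\in[0,T],\end{aligned}\tag{3.3}$$ with $Y(t)=0$ for $t\in(T,T+\delta]$, that is, (3.3) holds a.s. for a.e. $t\in[0,T]$, with the conditional expectations $E_s[\cdots]$ taken in a version jointly measurable in $(t,s,\omega)$, and $Z(t,s)=0$ for a.e. $0\le t\le s\le T+\delta$ with $s>T$. Then $\langle\rho,Y\rangle$ is integrable on $[0,T]\times\Omega$ and $$I(\chi)=E\int_0^T\langle\rho(t),Y(t)\rangle\,dt .$$ -/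

import Mathlib

open MeasureTheory ProbabilityTheory Set Filter Topology
open scoped NNReal ENNReal RealInnerProductSpace

noncomputable section

namespace NeutralSFDE

/-- `ℝⁿ` with the Euclidean norm. -/
abbrev Vec (n : ℕ) : Type := EuclideanSpace ℝ (Fin n)

/-- `ℝ^{n×d}` with the Euclidean (Frobenius) norm and inner product. -/
abbrev Mat (n d : ℕ) : Type := EuclideanSpace ℝ (Fin n × Fin d)

/-- The matrix-vector product `A x`. -/
def Mat.mulVec {n d : ℕ} (A : Mat n d) (x : Fin d → ℝ) : Vec n :=
  WithLp.toLp 2 (fun i => ∑ j, A (i, j) * x j)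

variable {Ω : Type*} {mΩ : MeasurableSpace Ω}

/-- `W` is a `d`-dimensional Brownian motion: its components are independent standard real
Brownian motions. -/
structure IsBrownianMotion {d : ℕ} (W : Fin d → ℝ≥0 → Ω → ℝ) (P : Measure Ω) : Prop where
  measurable : ∀ j t, Measurable (W j t)
  brownian : ∀ j, IsBrownianReal (W j) P
  indep : iIndepFun (fun j ω t => W j t ω) P

/-- The natural filtration of `W`, augmented by the `P`-null sets. It is indexed by `ℝ`, with
`ℱ t = ℱ 0` for `t ≤ 0`. -/
def brownianFiltration {d : ℕ} {W : Fin d → ℝ≥0 → Ω → ℝ} {P : Measure Ω}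
    (hW : IsBrownianMotion W P) : Filtration ℝ mΩ where
  seq t := (⨆ j, ⨆ s, ⨆ _ : s ≤ t.toNNReal, MeasurableSpace.comap (W j s) inferInstance) ⊔
    MeasurableSpace.generateFrom {A | MeasurableSet A ∧ P A = 0}
  mono' := by
    intro s t hst
    refine sup_le_sup_right (iSup_mono fun j => iSup_mono fun u => iSup_le fun hu => ?_) _
    exact le_iSup_of_le (hu.trans (Real.toNNReal_le_toNNReal hst)) le_rfl
  le' := by
    intro t
    refine sup_le (iSup_le fun j => iSup_le fun s => iSup_le fun _ => ?_) ?_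
    · exact (hW.measurable j s).comap_le
    · exact MeasurableSpace.generateFrom_le fun A hA => hA.1

/-! ### The Itô integral -/

/-- A simple adapted `ℝ^{n×d}`-valued process `∑_{i<N} hᵢ 1_{(τᵢ, τᵢ₊₁]}` on `[a, b]`, where
`a ≤ τ₀ ≤ ⋯ ≤ τ_N ≤ b` and `hᵢ` is bounded and `ℱ_{τᵢ}`-measurable. -/
structure SimpleProcess (ℱ : Filtration ℝ mΩ) (n d : ℕ) (a b : ℝ) where
  N : ℕ
  τ : ℕ → ℝ
  mono : Monotone τ
  left_le : a ≤ τ 0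
  le_right : τ N ≤ b
  h : ℕ → Ω → Mat n d
  measurable : ∀ i, StronglyMeasurable[ℱ (τ i)] (h i)
  bounded : ∃ C : ℝ, ∀ i ω, ‖h i ω‖ ≤ C

/-- The value of a simple process at time `t`. -/
def SimpleProcess.eval {ℱ : Filtration ℝ mΩ} {n d : ℕ} {a b : ℝ} (S : SimpleProcess ℱ n d a b)
    (t : ℝ) (ω : Ω) : Mat n d :=
  ∑ i ∈ Finset.range S.N, (Ioc (S.τ i) (S.τ (i + 1))).indicator (fun _ => S.h i ω) t

/-- The elementary stochastic integral `∑_{i<N} hᵢ (W(τᵢ₊₁) - W(τᵢ))`. -/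
def SimpleProcess.integral {ℱ : Filtration ℝ mΩ} {n d : ℕ} {a b : ℝ}
    (S : SimpleProcess ℱ n d a b) (W : Fin d → ℝ≥0 → Ω → ℝ) (ω : Ω) : Vec n :=
  ∑ i ∈ Finset.range S.N,
    (S.h i ω).mulVec (fun j => W j (S.τ (i + 1)).toNNReal ω - W j (S.τ i).toNNReal ω)

/-- `ξ = ∫_a^b H(s) dW(s)` almost surely, in the sense of Itô (`0 ≤ a`): `H` is a limit, in
`L²([a, b] × Ω)`, of simple adapted processes whose elementary integrals tend to `ξ` in `L²(Ω)`. -/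
def IsItoIntegral {n d : ℕ} (W : Fin d → ℝ≥0 → Ω → ℝ) (ℱ : Filtration ℝ mΩ) (P : Measure Ω)
    (a b : ℝ) (H : ℝ → Ω → Mat n d) (ξ : Ω → Vec n) : Prop :=
  MemLp (fun p : ℝ × Ω => H p.1 p.2) 2 ((volume.restrict (Icc a b)).prod P) ∧
  MemLp ξ 2 P ∧
  ∃ S : ℕ → SimpleProcess ℱ n d a b,
    Tendsto (fun k => eLpNorm (fun p : ℝ × Ω => H p.1 p.2 - (S k).eval p.1 p.2) 2
      ((volume.restrict (Icc a b)).prod P)) atTop (𝓝 0) ∧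
    Tendsto (fun k => eLpNorm (fun ω => ξ ω - (S k).integral W ω) 2 P) atTop (𝓝 0)

/-! ### Spaces of processes -/

/-- `θ ∈ L²_𝔽(a, b; V)`: `θ` is measurable, adapted, and `E ∫_a^b |θ(t)|² dt < ∞`. -/
structure MemL2F {V : Type*} [NormedAddCommGroup V] (ℱ : Filtration ℝ mΩ) (P : Measure Ω)
    (a b : ℝ) (θ : ℝ → Ω → V) : Prop where
  measurable : StronglyMeasurable (fun p : ℝ × Ω => θ p.1 p.2)
  adapted : ∀ t ∈ Icc a b, StronglyMeasurable[ℱ t] (θ t)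
  memLp : MemLp (fun p : ℝ × Ω => θ p.1 p.2) 2 ((volume.restrict (Icc a b)).prod P)

/-- `(Y, Z) ∈ M²(0, S)`: `Y` and `Z` are square integrable and adapted (`Z(t, s)` in the variable
`s`), and `Y(t) = E[Y(t)] + ∫_0^t Z(t, s) dW(s)` for almost every `t ∈ [0, S]`. -/
structure MemM2 {n d : ℕ} (W : Fin d → ℝ≥0 → Ω → ℝ) (ℱ : Filtration ℝ mΩ) (P : Measure Ω)
    (S : ℝ) (Y : ℝ → Ω → Vec n) (Z : ℝ → ℝ → Ω → Mat n d) : Prop where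
  memY : MemL2F ℱ P 0 S Y
  measurableZ : StronglyMeasurable (fun p : ℝ × ℝ × Ω => Z p.1 p.2.1 p.2.2)
  adaptedZ : ∀ t ∈ Icc 0 S, ∀ s ∈ Icc 0 S, StronglyMeasurable[ℱ s] (Z t s)
  memLpZ : MemLp (fun p : ℝ × ℝ × Ω => Z p.1 p.2.1 p.2.2) 2
    ((volume.restrict (Icc 0 S)).prod ((volume.restrict (Icc 0 S)).prod P))
  repr : ∀ᵐ t ∂(volume.restrict (Icc 0 S)),
    IsItoIntegral W ℱ P 0 t (Z t) (fun ω => Y t ω - ∫ ω', Y t ω' ∂P)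

/-! ### Coefficients -/

/-- `A(t, r)` is an adapted random delay density with respect to the probability measure `lam` on
`[0, δ]`, such that the functionals `φ ↦ ∫ A(t, r) φ(r) lam(dr)` are bounded uniformly in
`(t, ω)`, i.e. the total variations `∫ |A(t, r)| lam(dr)` are. -/
structure IsDelayDensity {V : Type*} [NormedAddCommGroup V] (ℱ : Filtration ℝ mΩ)
    (T δ : ℝ) (lam : Measure ℝ) (A : ℝ → Ω → ℝ → V) : Prop where
  prob : IsProbabilityMeasure lam
  support : lam (Icc 0 δ)ᶜ = 0
  measurable : StronglyMeasurable (fun p : ℝ × Ω × ℝ => A p.1 p.2.1 p.2.2)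
  adapted : ∀ t ∈ Icc 0 T, ∀ r, StronglyMeasurable[ℱ t] (fun ω => A t ω r)
  bounded : ∃ C : ℝ≥0, ∀ t ∈ Icc 0 T, ∀ ω, ∫⁻ r, ‖A t ω r‖ₑ ∂lam ≤ C

/-- A measurable, adapted, bounded coefficient on `[0, T]`. -/
structure IsBoundedCoeff {V : Type*} [NormedAddCommGroup V] (ℱ : Filtration ℝ mΩ)
    (T : ℝ) (A : ℝ → Ω → V) : Prop where
  measurable : StronglyMeasurable (fun p : ℝ × Ω => A p.1 p.2)
  adapted : ∀ t ∈ Icc 0 T, StronglyMeasurable[ℱ t] (A t)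
  bounded : ∃ C : ℝ, ∀ t ∈ Icc 0 T, ∀ ω, ‖A t ω‖ ≤ C

/-- The data of the linear problem: delay measures `λ₀, …, λ₃`, delay densities
`G, B` (`n×n` matrices), `Sig` (linear maps `ℝⁿ → ℝ^{n×d}`), `L` (row vectors), and the control
coefficients `bu`, `su`. Matrices acting on vectors are represented by linear maps and
the row vector `L` by a vector acting through the inner product. -/
structure LinearData (Ω : Type*) (n m d : ℕ) where
  lam0 : Measure ℝ
  lam1 : Measure ℝ
  lam2 : Measure ℝ
  lam3 : Measure ℝ
  G : ℝ → Ω → ℝ → (Vec n →L[ℝ] Vec n)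
  B : ℝ → Ω → ℝ → (Vec n →L[ℝ] Vec n)
  Sig : ℝ → Ω → ℝ → (Vec n →L[ℝ] Mat n d)
  L : ℝ → Ω → ℝ → Vec n
  bu : ℝ → Ω → (Vec m →L[ℝ] Vec n)
  su : ℝ → Ω → (Vec m →L[ℝ] Mat n d)

/-- The standing assumptions on the data; `L` is extended by `0` after time `T`. -/
structure LinearData.Admissible {n m d : ℕ} (D : LinearData Ω n m d) (ℱ : Filtration ℝ mΩ)
    (T δ : ℝ) : Prop where
  densityG : IsDelayDensity ℱ T δ D.lam0 D.G
  densityB : IsDelayDensity ℱ T δ D.lam1 D.B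
  densitySig : IsDelayDensity ℱ T δ D.lam2 D.Sig
  densityL : IsDelayDensity ℱ T δ D.lam3 D.L
  L_eq_zero : ∀ t, T < t → ∀ ω r, D.L t ω r = 0
  coeffb : IsBoundedCoeff ℱ T D.bu
  coeffs : IsBoundedCoeff ℱ T D.su

/-! ### The forward equation -/

/-- The delay integral `∫_0^δ A(t, r) χ(t - r) lam(dr)`. -/
def delayInt {n : ℕ} {V : Type*} [NormedAddCommGroup V] [NormedSpace ℝ V] (lam : Measure ℝ)
    (A : ℝ → Ω → ℝ → (Vec n →L[ℝ] V)) (χ : ℝ → Ω → Vec n) (t : ℝ) (ω : Ω) : V :=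
  ∫ r, A t ω r (χ (t - r) ω) ∂lam

/-- The delay integral converges absolutely and is square integrable:
`E ∫_0^T (∫_0^δ |A(t, r) χ(t - r)| lam(dr))² dt < ∞`. -/
def DelaySqIntegrable {n : ℕ} {V : Type*} [NormedAddCommGroup V] [NormedSpace ℝ V]
    (P : Measure Ω) (T : ℝ) (lam : Measure ℝ)
    (A : ℝ → Ω → ℝ → (Vec n →L[ℝ] V)) (χ : ℝ → Ω → Vec n) : Prop :=
  ∫⁻ p, (∫⁻ r, ‖A p.1 p.2 r (χ (p.1 - r) p.2)‖ₑ ∂lam) ^ 2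
    ∂((volume.restrict (Icc 0 T)).prod P) < ∞

/-- `χ ∈ L²_𝔽(-δ, T; ℝⁿ)` solves the linear neutral stochastic functional differential equation
`χ(t) - ∫ G(t, r) χ(t - r) λ₀(dr) = ∫_0^t [∫ B(s, r) χ(s - r) λ₁(dr) + bu(s) v(s)] ds
  + ∫_0^t [∫ Sig(s, r) χ(s - r) λ₂(dr) + su(s) v(s)] dW(s)` on `[0, T]`, `χ = 0` on `[-δ, 0]`. -/
structure IsForwardSolution {n m d : ℕ} (W : Fin d → ℝ≥0 → Ω → ℝ) (ℱ : Filtration ℝ mΩ)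
    (P : Measure Ω) (T δ : ℝ) (D : LinearData Ω n m d) (v : ℝ → Ω → Vec m)
    (χ : ℝ → Ω → Vec n) : Prop where
  mem : MemL2F ℱ P (-δ) T χ
  sqG : DelaySqIntegrable P T D.lam0 D.G χ
  sqB : DelaySqIntegrable P T D.lam1 D.B χ
  sqSig : DelaySqIntegrable P T D.lam2 D.Sig χ
  init : ∀ᵐ t ∂(volume.restrict (Icc (-δ) 0)), ∀ᵐ ω ∂P, χ t ω = 0
  eq : ∀ᵐ t ∂(volume.restrict (Icc 0 T)),
    IsItoIntegral W ℱ P 0 t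
      (fun s ω => delayInt D.lam2 D.Sig χ s ω + D.su s ω (v s ω))
      (fun ω => χ t ω - delayInt D.lam0 D.G χ t ω
        - ∫ s in (0 : ℝ)..t, (delayInt D.lam1 D.B χ s ω + D.bu s ω (v s ω)))

/-- The functional `I(χ) = E ∫_0^T ∫_0^δ L(t, r) χ(t - r) λ₃(dr) dt`. -/
def costFunctional {n m d : ℕ} (P : Measure Ω) (T : ℝ) (D : LinearData Ω n m d)
    (χ : ℝ → Ω → Vec n) : ℝ :=
  ∫ ω, (∫ t in (0 : ℝ)..T, (∫ r, ⟪D.L t ω r, χ (t - r) ω⟫ ∂D.lam3)) ∂P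

/-- The functional `I(χ)` is well defined: `E ∫_0^T ∫_0^δ |⟨L(t, r), χ(t - r)⟩| λ₃(dr) dt < ∞`. -/
def CostDefined {n m d : ℕ} (P : Measure Ω) (T : ℝ) (D : LinearData Ω n m d)
    (χ : ℝ → Ω → Vec n) : Prop :=
  ∫⁻ p, (∫⁻ r, ‖⟪D.L p.1 p.2 r, χ (p.1 - r) p.2⟫‖ₑ ∂D.lam3)
    ∂((volume.restrict (Icc 0 T)).prod P) < ∞

/-- `ρ` is a measurable version of the process
`ρ(t) = ∫_0^t bu(s) v(s) ds + ∫_0^t su(s) v(s) dW(s)`, `t ∈ [0, T]`. -/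
structure IsControlForcing {n m d : ℕ} (W : Fin d → ℝ≥0 → Ω → ℝ) (ℱ : Filtration ℝ mΩ)
    (P : Measure Ω) (T : ℝ) (D : LinearData Ω n m d) (v : ℝ → Ω → Vec m)
    (ρ : ℝ → Ω → Vec n) : Prop where
  measurable : StronglyMeasurable (fun p : ℝ × Ω => ρ p.1 p.2)
  eq : ∀ t ∈ Icc 0 T,
    IsItoIntegral W ℱ P 0 t (fun s ω => D.su s ω (v s ω))
      (fun ω => ρ t ω - ∫ s in (0 : ℝ)..t, D.bu s ω (v s ω))

/-! ### The backward equation -/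

/-- `∫_0^δ G'(t+r, r) Y(t+r) λ₀(dr)`. -/
def backwardG {n m d : ℕ} (D : LinearData Ω n m d) (Y : ℝ → Ω → Vec n) (t : ℝ) (ω : Ω) : Vec n :=
  ∫ r, ContinuousLinearMap.adjoint (D.G (t + r) ω r) (Y (t + r) ω) ∂D.lam0

/-- `∫_0^δ B'(t+r, r) Y(s+r) λ₁(dr) + ∫_0^δ Sig'(t+r, r) Z(s+r, t+r) λ₂(dr)`. -/
def backwardF {n m d : ℕ} (D : LinearData Ω n m d) (Y : ℝ → Ω → Vec n)
    (Z : ℝ → ℝ → Ω → Mat n d) (t s : ℝ) (ω : Ω) : Vec n :=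
  (∫ r, ContinuousLinearMap.adjoint (D.B (t + r) ω r) (Y (s + r) ω) ∂D.lam1)
    + ∫ r, ContinuousLinearMap.adjoint (D.Sig (t + r) ω r) (Z (s + r) (t + r) ω) ∂D.lam2

/-- `(Y, Z) ∈ M²(0, T+δ)` is an adapted M-solution of the linear backward equation
`Y(t) - E_t[∫ G'(t+r, r) Y(t+r) λ₀(dr)] = ∫ L(t+r, r) λ₃(dr)
  + ∫_t^T E_s[∫ B'(t+r, r) Y(s+r) λ₁(dr) + ∫ Sig'(t+r, r) Z(s+r, t+r) λ₂(dr)] ds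
  - ∫_t^T Z(t, s) dW(s)` for a.e. `t ∈ [0, T]`, with `Y = 0` on `(T, T+δ]` and `Z(t, s) = 0`
for `0 ≤ t ≤ s ≤ T+δ`, `s > T`. The process `η(t, s)` is a version of the conditional
expectation `E_s[…]` that is jointly measurable, so that it can be integrated in `s`. -/
structure IsAdaptedMSolution {n m d : ℕ} (W : Fin d → ℝ≥0 → Ω → ℝ) (ℱ : Filtration ℝ mΩ)
    (P : Measure Ω) (T δ : ℝ) (D : LinearData Ω n m d)
    (Y : ℝ → Ω → Vec n) (Z : ℝ → ℝ → Ω → Mat n d) : Prop where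
  mem : MemM2 W ℱ P (T + δ) Y Z
  terminal : ∀ᵐ t ∂(volume.restrict (Ioc T (T + δ))), ∀ᵐ ω ∂P, Y t ω = 0
  Z_eq_zero : ∀ᵐ t ∂(volume.restrict (Icc 0 (T + δ))),
    ∀ᵐ s ∂(volume.restrict (Icc t (T + δ))), T < s → ∀ᵐ ω ∂P, Z t s ω = 0
  eq : ∃ η : ℝ → ℝ → Ω → Vec n,
    StronglyMeasurable (fun p : ℝ × ℝ × Ω => η p.1 p.2.1 p.2.2) ∧
    (∀ᵐ t ∂(volume.restrict (Icc 0 T)), ∀ᵐ s ∂(volume.restrict (Icc t T)),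
      η t s =ᵐ[P] P[backwardF D Y Z t s | ℱ s]) ∧
    ∀ᵐ t ∂(volume.restrict (Icc 0 T)),
      IsItoIntegral W ℱ P t T (Z t)
        (fun ω => (∫ r, D.L (t + r) ω r ∂D.lam3) + (∫ s in t..T, η t s ω)
          - (Y t ω - (P[backwardG D Y t | ℱ t]) ω))

end NeutralSFDE

end

open NeutralSFDE

/-! # Duality between the forward equation with delay and the backward Volterra equation

Fix a time `t`. Pair the forward equation with `Y t`. Since `ρ` has the same control terms as the
forward equation, they cancel, and the Itô isometry, together with the representation of `Y t`
as a stochastic integral of `Z t`, expresses `E⟪ρ t, Y t⟫` through `E⟪χ t, Y t⟫` and the pairings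
of the delay terms `Gχ (t)`, `Bχ (s)`, `Σχ (s)`, `s ≤ t`, with `Y t`, `Y t`, `Z t s`
(`integral_inner_forward`). Pair the backward equation with `χ t`, which is `ℱ t`-measurable. Its
stochastic integral from `t` to `T` is orthogonal to `ℱ t`, and the conditional expectations at
times `s ≥ t` may be dropped, so that `E⟪χ t, Y t⟫` is a sum of pairings of `χ t` with the free term
and with the advanced terms in `Y (t + r)`, `Y (s + r)` and `Z (s + r) (t + r)`
(`integral_inner_backward`).

Subtract, integrate over `t ∈ [0, T]`, and use Fubini's theorem on the triangle `0 ≤ t ≤ s ≤ T`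
(`integral_triangle`, `integral_triangle_symm`). Each delay term is then the adjoint of the advanced
term with the same density: the substitution `t ↦ t + r`, respectively `(t, s) ↦ (t + r, s + r)`,
preserves the measure and carries one pairing to the other (`integral_inner_shift`,
`setIntegral_inner_delay_time`, `setIntegral_inner_delay_triangle`). The boundary contributions
vanish because `χ = 0` before time `0` and `Y = 0` after time `T`. The latter forces
`Z (t, s) = 0` for `s ≤ t`, `t > T` as well, by the isometry (`IsAdaptedMSolution.ae_Z_eq_zero`).
What remains is the pairing of `χ` with the free term, which the same substitution turns into the
cost functional (`costFunctional_eq`).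

The densities are only bounded in total variation, so that the advanced terms need not be square
integrable, and their pairings with `χ` need not make sense by the Cauchy-Schwarz inequality.
Integrability is instead carried over, by the same substitution, from the pairings of the delay
terms, which are square integrable by assumption. -/

noncomputable section

namespace NeutralSFDE

/-! ### Increments of Brownian motion -/

section Brownian

variable {Ω : Type*} {mΩ : MeasurableSpace Ω} {P : Measure Ω}

theorem iIndepFun_bool {β : Bool → Type*} {mβ : ∀ b, MeasurableSpace (β b)}
    [IsProbabilityMeasure P] {f : ∀ b, Ω → β b} (h : IndepFun (f true) (f false) P) :
    iIndepFun f P := by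
  rw [iIndepFun_iff_measure_inter_preimage_eq_mul]
  have key : ∀ S : Finset Bool, S = ∅ ∨ S = {true} ∨ S = {false} ∨ S = {true, false} := by decide
  intro S sets hsets
  rcases key S with rfl | rfl | rfl | rfl
  · simp
  · simp
  · simp
  · have := h.measure_inter_preimage_eq_mul (sets true) (sets false)
      (hsets true (by simp)) (hsets false (by simp))
    simpa [Finset.set_biInter_insert, -Finset.mem_insert] using this

/-- Adjoining null sets to a σ-algebra preserves independence. -/
theorem indep_sup_null {m₁ m₂ : MeasurableSpace Ω} (h : Indep m₁ m₂ P) :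
    Indep (m₁ ⊔ MeasurableSpace.generateFrom {A | MeasurableSet[mΩ] A ∧ P A = 0}) m₂ P := by
  have hle : m₁ ⊔ MeasurableSpace.generateFrom {A | MeasurableSet[mΩ] A ∧ P A = 0}
      ≤ @eventuallyMeasurableSpace Ω m₁ (ae P) _ := by
    refine sup_le (@le_eventuallyMeasurableSpace Ω m₁ (ae P) _) ?_
    refine MeasurableSpace.generateFrom_le fun A hA => ?_
    exact ⟨∅, @MeasurableSet.empty _ m₁, by
      rw [ae_eq_empty]; exact hA.2⟩
  refine indep_of_indep_of_le_left ?_ hle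
  rw [Indep_iff] at h ⊢
  rintro A B ⟨A', hA', hAA'⟩ hB
  rw [measure_congr hAA', ← h A' B hA' hB]
  exact measure_congr (hAA'.inter (EventuallyEq.refl _ _))

/-- The increments of the Brownian motion after time `s` are independent of `ℱ s`. -/
theorem indep_increments [IsProbabilityMeasure P] {d : ℕ} {W : Fin d → ℝ≥0 → Ω → ℝ}
    (hW : IsBrownianMotion W P) (s : ℝ) :
    Indep (brownianFiltration hW s)
      (⨆ j, MeasurableSpace.comap (fun ω (u : ℝ≥0) => W j (s.toNNReal + u) ω - W j s.toNNReal ω)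
        inferInstance) P := by
  simp only [brownianFiltration]
  refine indep_sup_null ?_
  set r := s.toNNReal
  -- `X j false` is the path of the `j`-th component stopped at `r`, `X j true` its increments after
  -- `r`; all these paths, over `j` and both values of the index, are jointly independent
  let X : Fin d → Bool → Ω → (ℝ≥0 → ℝ) := fun j b ω u =>
    if b then W j (r + u) ω - W j r ω else W j (min u r) ω
  have hm := hW.measurable
  have mX : ∀ j b, Measurable (X j b) := by
    intro j b
    refine measurable_pi_lambda _ fun u => ?_
    cases b
    · simpa [X] using hm j _
    · exact (hm j _).sub (hm j _)
  have h1 : iIndepFun (fun j ω => (X j · ω)) P := by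
    refine hW.indep.comp (fun _ (w : ℝ≥0 → ℝ) (b : Bool) (u : ℝ≥0) =>
      if b then w (r + u) - w r else w (min u r)) ?_
    intro j
    refine measurable_pi_lambda _ fun b => measurable_pi_lambda _ fun u => ?_
    cases b
    · simpa using measurable_pi_apply (min u r)
    · exact (measurable_pi_apply (r + u)).sub (measurable_pi_apply r)
  have h2 : ∀ j, iIndepFun (X j) P := by
    intro j
    refine iIndepFun_bool ?_
    have := (hW.brownian j).toIsPreBrownianReal.indepFun_shift r
    exact this.comp (φ := fun w => w)
      (ψ := fun (w : Set.Iic r → ℝ) (u : ℝ≥0) => w ⟨min u r, Set.mem_Iic.2 (min_le_right u r)⟩)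
      measurable_id
      (measurable_pi_lambda _ fun u =>
        measurable_pi_apply (⟨min u r, Set.mem_Iic.2 (min_le_right u r)⟩ : Set.Iic r))
  have h3 : iIndepFun (fun (p : Fin d × Bool) ω => X p.1 p.2 ω) P := iIndepFun_uncurry' mX h1 h2
  have h4 := indep_iSup_of_disjoint (fun p : Fin d × Bool => (mX p.1 p.2).comap_le) h3
    (S := {p | p.2 = false}) (T := {p | p.2 = true})
    (by rw [Set.disjoint_left]; intro p h h'; simp_all)
  refine indep_of_indep_of_le h4 ?_ ?_
  · refine iSup_le fun j => iSup_le fun u => iSup_le fun hu => ?_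
    refine le_trans ?_ (le_iSup₂_of_le (j, false) rfl le_rfl)
    rintro _ ⟨B, hB, rfl⟩
    refine ⟨(fun w => w u) ⁻¹' B, measurable_pi_apply u hB, ?_⟩
    ext ω
    simp [X, min_eq_left hu]
  · refine iSup_le fun j => ?_
    exact le_iSup₂_of_le (j, true) rfl le_rfl

/-- The increment `W_j(b) - W_j(a)` of the `j`-th component over `[a, b]`. -/
def incr {d : ℕ} (W : Fin d → ℝ≥0 → Ω → ℝ) (j : Fin d) (a b : ℝ) (ω : Ω) : ℝ :=
  W j b.toNNReal ω - W j a.toNNReal ω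

variable {d : ℕ} {W : Fin d → ℝ≥0 → Ω → ℝ}

theorem measurable_incr (hW : IsBrownianMotion W P) (j : Fin d) (a b : ℝ) :
    Measurable (incr W j a b) :=
  (hW.measurable j _).sub (hW.measurable j _)

theorem incr_eq_add (j : Fin d) (a b c : ℝ) (ω : Ω) :
    incr W j a c ω = incr W j a b ω + incr W j b c ω := by
  simp [incr]

/-- The increment over `[a, b]` is `ℱ b`-measurable. -/
theorem measurable_incr_filtration (hW : IsBrownianMotion W P) (j : Fin d) {a b : ℝ}
    (hab : a ≤ b) : Measurable[brownianFiltration hW b] (incr W j a b) := by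
  have h : ∀ c ≤ b, Measurable[brownianFiltration hW b] (W j c.toNNReal) := by
    intro c hc
    have h1 : MeasurableSpace.comap (W j c.toNNReal) inferInstance ≤ brownianFiltration hW b := by
      refine le_trans ?_ le_sup_left
      exact le_iSup_of_le j (le_iSup₂_of_le c.toNNReal (Real.toNNReal_le_toNNReal hc) le_rfl)
    exact Measurable.of_comap_le h1
  exact (h b le_rfl).sub (h a hab)

theorem memLp_incr (hW : IsBrownianMotion W P) (j : Fin d) (a b : ℝ) :
    MemLp (incr W j a b) 2 P := by
  have h := (hW.brownian j).toIsPreBrownianReal.hasLaw_sub b.toNNReal a.toNNReal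
  exact h.hasGaussianLaw.memLp_two

theorem integral_incr (hW : IsBrownianMotion W P) (j : Fin d) (a b : ℝ) :
    ∫ ω, incr W j a b ω ∂P = 0 := by
  have h := (hW.brownian j).toIsPreBrownianReal
  simp only [incr]
  rw [integral_sub (h.integrable_eval _) (h.integrable_eval _), h.integral_eval, h.integral_eval,
    sub_zero]

theorem integral_incr_mul_incr (hW : IsBrownianMotion W P) (j l : Fin d) {a b : ℝ}
    (ha : 0 ≤ a) (hab : a ≤ b) :
    ∫ ω, incr W j a b ω * incr W l a b ω ∂P = if j = l then b - a else 0 := by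
  split_ifs with hjl
  · subst hjl
    have h := (hW.brownian j).toIsPreBrownianReal
    have hl := h.hasLaw_sub b.toNNReal a.toNNReal
    have hv := hl.variance_eq
    rw [variance_id_gaussianReal] at hv
    have hpm : IsProbabilityMeasure P := hl.isProbabilityMeasure
    have hvi := variance_of_integral_eq_zero (measurable_incr hW j a b).aemeasurable
      (integral_incr hW j a b)
    have : ∀ ω, incr W j a b ω * incr W j a b ω = (incr W j a b ^ 2) ω := by
      intro ω; simp [sq]
    simp_rw [this]
    refine hvi.symm.trans (Eq.trans hv ?_)
    rw [coe_nndist, Real.dist_eq]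
    change |((b.toNNReal : ℝ≥0) : ℝ) - ((a.toNNReal : ℝ≥0) : ℝ)| = _
    rw [Real.coe_toNNReal _ ha, Real.coe_toNNReal _ (ha.trans hab), abs_of_nonneg (by linarith)]
  · have hind : IndepFun (incr W j a b) (incr W l a b) P :=
      (hW.indep.indepFun hjl).comp (φ := fun w : ℝ≥0 → ℝ => w b.toNNReal - w a.toNNReal)
        (ψ := fun w : ℝ≥0 → ℝ => w b.toNNReal - w a.toNNReal) (by fun_prop) (by fun_prop)
    have := hind.integral_mul_eq_mul_integral (measurable_incr hW j a b).aestronglyMeasurable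
      (measurable_incr hW l a b).aestronglyMeasurable
    rw [integral_incr hW, zero_mul] at this
    exact this

variable [IsProbabilityMeasure P]

/-- Functions of the increment over `[a, b]` are independent of `ℱ a`-measurable variables. -/
theorem indepFun_of_increments (hW : IsBrownianMotion W P) {a b : ℝ} (ha : 0 ≤ a) (hab : a ≤ b)
    {f : Ω → ℝ} (hf : Measurable[brownianFiltration hW a] f) {φ : (Fin d → ℝ) → ℝ}
    (hφ : Measurable φ) : IndepFun f (fun ω => φ (fun j => incr W j a b ω)) P := by
  have h := indep_increments hW a
  rw [IndepFun_iff_Indep]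
  refine indep_of_indep_of_le h hf.comap_le ?_
  refine Measurable.comap_le ?_
  refine hφ.comp (@measurable_pi_lambda Ω (Fin d) (fun _ => ℝ) (_) _ _ fun j => ?_)
  have h2 := (measurable_pi_apply (b - a).toNNReal).comp (comap_measurable
    (fun ω (u : ℝ≥0) => W j (a.toNNReal + u) ω - W j a.toNNReal ω))
  have h3 := h2.mono (le_iSup (fun j => MeasurableSpace.comap
    (fun ω (u : ℝ≥0) => W j (a.toNNReal + u) ω - W j a.toNNReal ω) inferInstance) j) le_rfl
  convert h3 using 2 with ω
  simp [incr, ← Real.toNNReal_add ha (sub_nonneg.2 hab)]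

/-- `E[f ΔW_j] = 0` for `f` measurable at the beginning of the time interval. -/
theorem integral_mul_incr (hW : IsBrownianMotion W P) {a b : ℝ} (ha : 0 ≤ a) (hab : a ≤ b)
    {f : Ω → ℝ} (hf : Measurable[brownianFiltration hW a] f) (j : Fin d) :
    ∫ ω, f ω * incr W j a b ω ∂P = 0 := by
  have h := indepFun_of_increments hW ha hab hf (φ := fun x => x j) (measurable_pi_apply j)
  have h2 := h.integral_mul_eq_mul_integral
    ((hf.mono ((brownianFiltration hW).le a) le_rfl).aestronglyMeasurable)
    (measurable_incr hW j a b).aestronglyMeasurable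
  rw [integral_incr hW, mul_zero] at h2
  exact h2

/-- `E[f ΔW_j ΔW_l] = δ_{jl} (b - a) E[f]` for `f` measurable at the beginning `a` of the time
interval `[a, b]`. -/
theorem integral_mul_incr_mul_incr (hW : IsBrownianMotion W P) {a b : ℝ} (ha : 0 ≤ a)
    (hab : a ≤ b) {f : Ω → ℝ} (hf : Measurable[brownianFiltration hW a] f) (j l : Fin d) :
    ∫ ω, f ω * (incr W j a b ω * incr W l a b ω) ∂P
      = (if j = l then b - a else 0) * ∫ ω, f ω ∂P := by
  have h := indepFun_of_increments hW ha hab hf (φ := fun x => x j * x l)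
    ((measurable_pi_apply j).mul (measurable_pi_apply l))
  have h2 := h.integral_mul_eq_mul_integral
    ((hf.mono ((brownianFiltration hW).le a) le_rfl).aestronglyMeasurable)
    ((measurable_incr hW j a b).mul (measurable_incr hW l a b)).aestronglyMeasurable
  rw [integral_incr_mul_incr hW j l ha hab] at h2
  rw [mul_comm]
  exact h2

/-- `E[F (W_j(b) - W_j(a)) (W_l(b') - W_l(a'))] = δ_{jl} |[a, b] ∩ [a', b']| E[F]` if `F` is known
at the later of the two initial times. -/
theorem integral_mul_incr_mul_incr_overlap (hW : IsBrownianMotion W P) {a b a' b' : ℝ}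
    (ha : 0 ≤ a) (hab : a ≤ b) (haa' : a ≤ a') (hab' : a' ≤ b') {f : Ω → ℝ}
    (hf : Measurable[brownianFiltration hW a'] f) {C : ℝ} (hC : ∀ ω, ‖f ω‖ ≤ C) (j l : Fin d) :
    ∫ ω, f ω * (incr W j a b ω * incr W l a' b' ω) ∂P
      = (if j = l then max 0 (min b b' - a') else 0) * ∫ ω, f ω ∂P := by
  have ha' : 0 ≤ a' := ha.trans haa'
  have hfm : AEStronglyMeasurable f P :=
    (hf.mono ((brownianFiltration hW).le a') le_rfl).aestronglyMeasurable
  have hint : ∀ (j l : Fin d) (p q p' q' : ℝ),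
      Integrable (fun ω => f ω * (incr W j p q ω * incr W l p' q' ω)) P := fun j l p q p' q' =>
    ((memLp_incr hW j p q).integrable_mul (memLp_incr hW l p' q')).bdd_mul (c := C) hfm
      (ae_of_all _ hC)
  -- a product in which one increment lies after the other one and after `a'` has mean zero
  have hzero : ∀ (j l : Fin d) (p q r s : ℝ), p ≤ q → q ≤ r → a' ≤ r → r ≤ s →
      ∫ ω, f ω * (incr W j p q ω * incr W l r s ω) ∂P = 0 := by
    intro j l p q r s hpq hqr har hrs
    have := integral_mul_incr hW (ha'.trans har) hrs (f := fun ω => f ω * incr W j p q ω)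
      ((hf.mono ((brownianFiltration hW).mono har) le_rfl).mul
        ((measurable_incr_filtration hW j hpq).mono
          ((brownianFiltration hW).mono hqr) le_rfl)) l
    simpa only [mul_assoc] using this
  rcases le_total b a' with hba | hba
  · rw [hzero j l a b a' b' hab hba le_rfl hab']
    rw [max_eq_left (by linarith [min_le_left b b'])]
    simp
  · set c := min b b' with hc
    have hca : a' ≤ c := le_min hba hab'
    have hmain := integral_mul_incr_mul_incr hW ha' hca hf j l
    rw [max_eq_right (by linarith)]
    rw [← hmain]
    -- split off the part of the first increment before `a'`
    have h1 : ∫ ω, f ω * (incr W j a b ω * incr W l a' b' ω) ∂P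
        = ∫ ω, f ω * (incr W j a' b ω * incr W l a' b' ω) ∂P := by
      have : ∀ ω, f ω * (incr W j a b ω * incr W l a' b' ω)
          = f ω * (incr W j a a' ω * incr W l a' b' ω)
            + f ω * (incr W j a' b ω * incr W l a' b' ω) := by
        intro ω; rw [incr_eq_add j a a' b]; ring
      simp_rw [this]
      rw [integral_add (hint _ _ _ _ _ _) (hint _ _ _ _ _ _),
        hzero j l a a' a' b' haa' le_rfl le_rfl hab', zero_add]
    rw [h1]
    rcases le_total b b' with hbb | hbb
    · have hcb : c = b := min_eq_left hbb
      rw [hcb] at hca ⊢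
      have : ∀ ω, f ω * (incr W j a' b ω * incr W l a' b' ω)
          = f ω * (incr W j a' b ω * incr W l a' b ω)
            + f ω * (incr W j a' b ω * incr W l b b' ω) := by
        intro ω; rw [incr_eq_add l a' b b']; ring
      simp_rw [this]
      rw [integral_add (hint _ _ _ _ _ _) (hint _ _ _ _ _ _),
        hzero j l a' b b b' hca le_rfl hca hbb, add_zero]
    · have hcb : c = b' := min_eq_right hbb
      rw [hcb] at hca ⊢
      have : ∀ ω, f ω * (incr W j a' b ω * incr W l a' b' ω)
          = f ω * (incr W j a' b' ω * incr W l a' b' ω)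
            + f ω * (incr W l a' b' ω * incr W j b' b ω) := by
        intro ω; rw [incr_eq_add j a' b' b]; ring
      simp_rw [this]
      rw [integral_add (hint _ _ _ _ _ _) (hint _ _ _ _ _ _),
        hzero l j a' b' b' b hca le_rfl hca hbb, add_zero]

end Brownian

/-! ### Elementary stochastic integrals -/

section Ito

variable {Ω : Type*} {mΩ : MeasurableSpace Ω} {P : Measure Ω}

theorem integrable_inner_of_memLp {α E : Type*} {mα : MeasurableSpace α} {μ : Measure α}
    [NormedAddCommGroup E] [InnerProductSpace ℝ E] {f g : α → E}
    (hf : MemLp f 2 μ) (hg : MemLp g 2 μ) : Integrable (fun x => ⟪f x, g x⟫) μ := by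
  refine (L2.integrable_inner (𝕜 := ℝ) (hf.toLp f) (hg.toLp g)).congr ?_
  filter_upwards [hf.coeFn_toLp, hg.coeFn_toLp] with x h1 h2
  rw [h1, h2]

/-- Continuity of the inner product of `L²` along sequences of functions. -/
theorem tendsto_integral_inner {α E : Type*} {mα : MeasurableSpace α} {μ : Measure α}
    [NormedAddCommGroup E] [InnerProductSpace ℝ E] {f g : α → E} {F G : ℕ → α → E}
    (hf : MemLp f 2 μ) (hg : MemLp g 2 μ) (hF : ∀ k, MemLp (F k) 2 μ) (hG : ∀ k, MemLp (G k) 2 μ)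
    (hfF : Tendsto (fun k => eLpNorm (fun x => f x - F k x) 2 μ) atTop (𝓝 0))
    (hgG : Tendsto (fun k => eLpNorm (fun x => g x - G k x) 2 μ) atTop (𝓝 0)) :
    Tendsto (fun k => ∫ x, ⟪F k x, G k x⟫ ∂μ) atTop (𝓝 (∫ x, ⟪f x, g x⟫ ∂μ)) := by
  have key : ∀ {u w : α → E} (hu : MemLp u 2 μ) (hw : MemLp w 2 μ),
      ∫ x, ⟪u x, w x⟫ ∂μ = ⟪hu.toLp u, hw.toLp w⟫ := by
    intro u w hu hw
    rw [L2.inner_def]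
    refine integral_congr_ae ?_
    filter_upwards [hu.coeFn_toLp, hw.coeFn_toLp] with x h1 h2
    rw [h1, h2]
  have conv : ∀ {u : α → E} {U : ℕ → α → E} (hu : MemLp u 2 μ) (hU : ∀ k, MemLp (U k) 2 μ),
      Tendsto (fun k => eLpNorm (fun x => u x - U k x) 2 μ) atTop (𝓝 0) →
      Tendsto (fun k => (hU k).toLp (U k)) atTop (𝓝 (hu.toLp u)) := by
    intro u U hu hU h
    rw [Lp.tendsto_Lp_iff_tendsto_eLpNorm'']
    refine h.congr fun k => ?_
    exact eLpNorm_sub_comm u (U k) 2 μ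
  rw [key hf hg]
  simp_rw [fun k => key (hF k) (hG k)]
  exact (conv hf hF hfF).inner (conv hg hG hgG)

variable {d n : ℕ} {W : Fin d → ℝ≥0 → Ω → ℝ}

theorem norm_apply_le {ι : Type*} [Fintype ι] (x : EuclideanSpace ℝ ι) (i : ι) : |x i| ≤ ‖x‖ := by
  simpa using PiLp.norm_apply_le x i

/-- The covariance of two increments weighted by coefficients known at their initial times: only
the overlap of the two time intervals contributes. -/
theorem integral_incr_pair [IsProbabilityMeasure P] (hW : IsBrownianMotion W P) {a b a' b' : ℝ}
    (ha : 0 ≤ a) (hab : a ≤ b) (ha' : 0 ≤ a') (hab' : a' ≤ b') {f g : Ω → ℝ}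
    (hf : Measurable[brownianFiltration hW a] f) (hg : Measurable[brownianFiltration hW a'] g)
    {C C' : ℝ} (hC : ∀ ω, ‖f ω‖ ≤ C) (hC' : ∀ ω, ‖g ω‖ ≤ C') (j l : Fin d) :
    ∫ ω, (f ω * incr W j a b ω) * (g ω * incr W l a' b' ω) ∂P
      = (if j = l then max 0 (min b b' - max a a') else 0) * ∫ ω, f ω * g ω ∂P := by
  have hbd : ∀ ω, ‖f ω * g ω‖ ≤ C * C' := fun ω => by
    rw [norm_mul]
    exact mul_le_mul (hC ω) (hC' ω) (norm_nonneg _) ((norm_nonneg _).trans (hC ω))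
  rcases le_total a a' with h | h
  · have := integral_mul_incr_mul_incr_overlap hW ha hab h hab' (f := fun ω => f ω * g ω)
      ((hf.mono ((brownianFiltration hW).mono h) le_rfl).mul hg) hbd j l
    rw [max_eq_right h, ← this]
    exact integral_congr_ae (ae_of_all _ fun ω => by ring)
  · have := integral_mul_incr_mul_incr_overlap hW ha' hab' h hab (f := fun ω => f ω * g ω)
      (hf.mul (hg.mono ((brownianFiltration hW).mono h) le_rfl)) hbd l j
    rw [max_eq_left h, min_comm b b']
    simp only [eq_comm (a := j)]
    rw [← this]
    exact integral_congr_ae (ae_of_all _ fun ω => by ring)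

theorem memLp_mul_incr (hW : IsBrownianMotion W P) {f : Ω → ℝ} (hf : AEStronglyMeasurable f P)
    {C : ℝ} (hC : ∀ ω, ‖f ω‖ ≤ C) (j : Fin d) (a b : ℝ) :
    MemLp (fun ω => f ω * incr W j a b ω) 2 P :=
  (memLp_incr hW j a b).mul (p := ∞) (q := 2) (memLp_top_of_bound hf C (ae_of_all _ hC))

/-- The polarized Itô isometry for single increments. -/
theorem integral_inner_mulVec_incr [IsProbabilityMeasure P] (hW : IsBrownianMotion W P)
    {a b a' b' : ℝ} (ha : 0 ≤ a) (hab : a ≤ b) (ha' : 0 ≤ a') (hab' : a' ≤ b')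
    {h h' : Ω → Mat n d} (hh : StronglyMeasurable[brownianFiltration hW a] h)
    (hh' : StronglyMeasurable[brownianFiltration hW a'] h')
    {C C' : ℝ} (hC : ∀ ω, ‖h ω‖ ≤ C) (hC' : ∀ ω, ‖h' ω‖ ≤ C') :
    ∫ ω, ⟪(h ω).mulVec (fun j => incr W j a b ω), (h' ω).mulVec (fun j => incr W j a' b' ω)⟫ ∂P
      = max 0 (min b b' - max a a') * ∫ ω, ⟪h ω, h' ω⟫ ∂P := by
  have mc : ∀ {c : ℝ} {u : Ω → Mat n d}, StronglyMeasurable[brownianFiltration hW c] u →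
      ∀ p, Measurable[brownianFiltration hW c] (fun ω => u ω p) := by
    intro c u hu p
    exact ((EuclideanSpace.proj (𝕜 := ℝ) p).continuous.comp_stronglyMeasurable hu).measurable
  have bd : ∀ {c : ℝ} {u : Ω → Mat n d}, (∀ ω, ‖u ω‖ ≤ c) → ∀ p ω, ‖u ω p‖ ≤ c :=
    fun hu p ω => (norm_apply_le _ p).trans (hu ω)
  have ae : ∀ {c : ℝ} {u : Ω → Mat n d}, StronglyMeasurable[brownianFiltration hW c] u →
      ∀ p, AEStronglyMeasurable (fun ω => u ω p) P := fun hu p =>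
    ((mc hu p).mono ((brownianFiltration hW).le _) le_rfl).aestronglyMeasurable
  have e1 : ∀ ω, ⟪(h ω).mulVec (fun j => incr W j a b ω),
      (h' ω).mulVec (fun j => incr W j a' b' ω)⟫
      = ∑ k, ∑ j, ∑ l, (h ω (k, j) * incr W j a b ω) * (h' ω (k, l) * incr W l a' b' ω) := by
    intro ω
    rw [PiLp.inner_apply]
    refine Finset.sum_congr rfl fun k _ => ?_
    simp only [Mat.mulVec, RCLike.inner_apply, conj_trivial]
    rw [mul_comm, Finset.sum_mul_sum]
  have int1 : ∀ k j l, Integrable (fun ω =>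
      (h ω (k, j) * incr W j a b ω) * (h' ω (k, l) * incr W l a' b' ω)) P := fun k j l =>
    (memLp_mul_incr hW (ae hh _) (bd hC _) j a b).integrable_mul
      (memLp_mul_incr hW (ae hh' _) (bd hC' _) l a' b')
  have int2 : ∀ p, Integrable (fun ω => h ω p * h' ω p) P := fun p =>
    (Integrable.of_bound (ae hh' p) C' (ae_of_all _ (bd hC' p))).bdd_mul (c := C) (ae hh p)
      (ae_of_all _ (bd hC p))
  have e2 : ∀ ω, ⟪h ω, h' ω⟫ = ∑ k, ∑ j, h ω (k, j) * h' ω (k, j) := by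
    intro ω
    rw [PiLp.inner_apply, ← Finset.univ_product_univ, Finset.sum_product]
    refine Finset.sum_congr rfl fun k _ => Finset.sum_congr rfl fun j _ => ?_
    simp [mul_comm]
  simp_rw [e1, e2]
  rw [integral_finsetSum _ fun k _ => integrable_finsetSum _ fun j _ =>
      integrable_finsetSum _ fun l _ => int1 k j l,
    integral_finsetSum _ fun k _ => integrable_finsetSum _ fun j _ => int2 (k, j),
    Finset.mul_sum]
  refine Finset.sum_congr rfl fun k _ => ?_
  rw [integral_finsetSum _ fun j _ => integrable_finsetSum _ fun l _ => int1 k j l,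
    integral_finsetSum _ fun j _ => int2 (k, j), Finset.mul_sum]
  refine Finset.sum_congr rfl fun j _ => ?_
  rw [integral_finsetSum _ fun l _ => int1 k j l]
  rw [Finset.sum_congr rfl fun l _ => integral_incr_pair hW ha hab ha' hab' (mc hh (k, j))
    (mc hh' (k, l)) (bd hC (k, j)) (bd hC' (k, l)) j l]
  simp

theorem memLp_mulVec_incr (hW : IsBrownianMotion W P) {h : Ω → Mat n d}
    (hh : StronglyMeasurable h) {C : ℝ} (hC : ∀ ω, ‖h ω‖ ≤ C) (a b : ℝ) :
    MemLp (fun ω => (h ω).mulVec (fun j => incr W j a b ω)) 2 P := by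
  rw [memLp_piLp_iff]
  intro k
  simp only [Mat.mulVec]
  refine memLp_finsetSum _ fun j _ => ?_
  refine memLp_mul_incr hW ?_ (fun ω => (norm_apply_le _ _).trans (hC ω)) j a b
  exact ((EuclideanSpace.proj (𝕜 := ℝ) (k, j)).continuous.comp_stronglyMeasurable
    hh).aestronglyMeasurable

end Ito

/-! ### The Itô isometry -/

section Simple

variable {Ω : Type*} {mΩ : MeasurableSpace Ω} {P : Measure Ω} {d n : ℕ}
  {W : Fin d → ℝ≥0 → Ω → ℝ}

theorem SimpleProcess.integral_eq {ℱ : Filtration ℝ mΩ} {a b : ℝ} (S : SimpleProcess ℱ n d a b)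
    (ω : Ω) : S.integral W ω = ∑ i ∈ Finset.range S.N,
      (S.h i ω).mulVec (fun j => incr W j (S.τ i) (S.τ (i + 1)) ω) := rfl

theorem SimpleProcess.memLp_integral (hW : IsBrownianMotion W P) {a b : ℝ}
    (S : SimpleProcess (brownianFiltration hW) n d a b) : MemLp (S.integral W) 2 P := by
  obtain ⟨C, hC⟩ := S.bounded
  exact memLp_finsetSum _ fun i _ => memLp_mulVec_incr hW
    ((S.measurable i).mono ((brownianFiltration hW).le _)) (hC i) _ _

theorem SimpleProcess.memLp_eval [IsFiniteMeasure P] {ℱ : Filtration ℝ mΩ} {a b : ℝ}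
    (S : SimpleProcess ℱ n d a b) :
    MemLp (fun p : ℝ × Ω => S.eval p.1 p.2) 2 ((volume.restrict (Icc a b)).prod P) := by
  obtain ⟨C, hC⟩ := S.bounded
  refine memLp_finsetSum _ fun i _ => ?_
  have hm : StronglyMeasurable (fun p : ℝ × Ω => S.h i p.2) :=
    ((S.measurable i).mono (ℱ.le _)).comp_measurable measurable_snd
  have heq : (fun p : ℝ × Ω => (Ioc (S.τ i) (S.τ (i + 1))).indicator (fun _ => S.h i p.2) p.1)
      = ((Prod.fst : ℝ × Ω → ℝ) ⁻¹' (Ioc (S.τ i) (S.τ (i + 1)))).indicator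
        (fun p : ℝ × Ω => S.h i p.2) := by
    ext1 p; simp [indicator]
  rw [heq]
  refine MemLp.indicator (measurable_fst measurableSet_Ioc) ?_
  exact MemLp.of_bound hm.aestronglyMeasurable C (ae_of_all _ fun p => hC i p.2)

/-- The polarized Itô isometry for simple processes, which may have different partitions. -/
theorem SimpleProcess.integral_inner_integral [IsProbabilityMeasure P]
    (hW : IsBrownianMotion W P) {a b : ℝ} (ha : 0 ≤ a)
    (S S' : SimpleProcess (brownianFiltration hW) n d a b) :
    ∫ ω, ⟪S.integral W ω, S'.integral W ω⟫ ∂P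
      = ∫ p : ℝ × Ω, ⟪S.eval p.1 p.2, S'.eval p.1 p.2⟫ ∂((volume.restrict (Icc a b)).prod P) := by
  obtain ⟨C, hC⟩ := S.bounded
  obtain ⟨C', hC'⟩ := S'.bounded
  have lower : ∀ (S : SimpleProcess (brownianFiltration hW) n d a b) i, a ≤ S.τ i :=
    fun S i => S.left_le.trans (S.mono (Nat.zero_le i))
  have upper : ∀ (S : SimpleProcess (brownianFiltration hW) n d a b), ∀ i ∈ Finset.range S.N,
      S.τ (i + 1) ≤ b := fun S i hi =>
    (S.mono (Nat.succ_le_of_lt (Finset.mem_range.1 hi))).trans S.le_right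
  have sm : ∀ (S : SimpleProcess (brownianFiltration hW) n d a b) i, StronglyMeasurable (S.h i) :=
    fun S i => (S.measurable i).mono ((brownianFiltration hW).le _)
  have hint : ∀ i k, Integrable (fun ω => ⟪S.h i ω, S'.h k ω⟫) P := fun i k =>
    Integrable.of_bound ((sm S i).inner (sm S' k)).aestronglyMeasurable (C * C')
      (ae_of_all _ fun ω => (norm_inner_le_norm _ _).trans
        (mul_le_mul (hC i ω) (hC' k ω) (norm_nonneg _) ((norm_nonneg _).trans (hC i ω))))
  have hL : ∀ ω, ⟪S.integral W ω, S'.integral W ω⟫ = ∑ i ∈ Finset.range S.N,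
      ∑ k ∈ Finset.range S'.N, ⟪(S.h i ω).mulVec (fun j => incr W j (S.τ i) (S.τ (i + 1)) ω),
        (S'.h k ω).mulVec (fun j => incr W j (S'.τ k) (S'.τ (k + 1)) ω)⟫ := by
    intro ω
    rw [S.integral_eq, S'.integral_eq, sum_inner]
    simp_rw [inner_sum]
  let I : ℕ → ℕ → Set ℝ := fun i k => Ioc (S.τ i) (S.τ (i + 1)) ∩ Ioc (S'.τ k) (S'.τ (k + 1))
  have hR : ∀ p : ℝ × Ω, ⟪S.eval p.1 p.2, S'.eval p.1 p.2⟫ = ∑ i ∈ Finset.range S.N,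
      ∑ k ∈ Finset.range S'.N, (I i k).indicator (fun _ => (1 : ℝ)) p.1
        * ⟪S.h i p.2, S'.h k p.2⟫ := by
    intro p
    simp only [SimpleProcess.eval]
    rw [sum_inner]
    simp_rw [inner_sum]
    refine Finset.sum_congr rfl fun i _ => Finset.sum_congr rfl fun k _ => ?_
    by_cases h1 : p.1 ∈ Ioc (S.τ i) (S.τ (i + 1)) <;>
      by_cases h2 : p.1 ∈ Ioc (S'.τ k) (S'.τ (k + 1)) <;> simp [I, indicator, h1, h2]
  have hIm : ∀ i k, MeasurableSet (I i k) := fun i k => measurableSet_Ioc.inter measurableSet_Ioc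
  have hind : ∀ i k, Integrable ((I i k).indicator (fun _ => (1 : ℝ)))
      (volume.restrict (Icc a b)) := fun i k => (integrable_const 1).indicator (hIm i k)
  have mem := fun (i k : ℕ) =>
    integrable_inner_of_memLp (memLp_mulVec_incr hW (sm S i) (hC i) (S.τ i) (S.τ (i + 1)))
      (memLp_mulVec_incr hW (sm S' k) (hC' k) (S'.τ k) (S'.τ (k + 1)))
  simp_rw [hL, hR]
  rw [integral_finsetSum _ fun i _ => integrable_finsetSum _ fun k _ => mem i k,
    integral_finsetSum _ fun i _ => integrable_finsetSum _ fun k _ =>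
      (hind i k).mul_prod (hint i k)]
  refine Finset.sum_congr rfl fun i hi => ?_
  rw [integral_finsetSum _ fun k _ => mem i k,
    integral_finsetSum _ fun k _ => (hind i k).mul_prod (hint i k)]
  refine Finset.sum_congr rfl fun k hk => ?_
  rw [integral_inner_mulVec_incr hW (ha.trans (lower S i)) (S.mono (Nat.le_succ i))
    (ha.trans (lower S' k)) (S'.mono (Nat.le_succ k)) (S.measurable i) (S'.measurable k) (hC i)
    (hC' k), integral_prod_mul ((I i k).indicator fun _ => (1 : ℝ))
    (fun ω => ⟪S.h i ω, S'.h k ω⟫)]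
  congr 1
  rw [integral_indicator (hIm i k), Measure.restrict_restrict (hIm i k)]
  have hsub : I i k ∩ Icc a b = Ioc (max (S.τ i) (S'.τ k)) (min (S.τ (i + 1)) (S'.τ (k + 1))) := by
    rw [← Ioc_inter_Ioc, inter_eq_left]
    exact inter_subset_left.trans fun t ht => ⟨(lower S i).trans ht.1.le, ht.2.trans (upper S i hi)⟩
  rw [hsub]
  simp [Real.volume_real_Ioc, max_comm]

/-- Elementary stochastic integrals over `[a, b]` are orthogonal to `ℱ a`. -/
theorem SimpleProcess.integral_inner_eq_zero [IsProbabilityMeasure P]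
    (hW : IsBrownianMotion W P) {a b : ℝ} (ha : 0 ≤ a)
    (S : SimpleProcess (brownianFiltration hW) n d a b) {X : Ω → Vec n}
    (hX : StronglyMeasurable[brownianFiltration hW a] X) (hX2 : MemLp X 2 P) :
    ∫ ω, ⟪X ω, S.integral W ω⟫ ∂P = 0 := by
  obtain ⟨C, hC⟩ := S.bounded
  have lower : ∀ i, a ≤ S.τ i := fun i => S.left_le.trans (S.mono (Nat.zero_le i))
  have mc : ∀ i p, Measurable[brownianFiltration hW (S.τ i)] (fun ω => S.h i ω p) := fun i p =>
    ((EuclideanSpace.proj (𝕜 := ℝ) p).continuous.comp_stronglyMeasurable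
      (S.measurable i)).measurable
  have mX : ∀ k, Measurable[brownianFiltration hW a] (fun ω => X ω k) := fun k =>
    ((EuclideanSpace.proj (𝕜 := ℝ) k).continuous.comp_stronglyMeasurable hX).measurable
  have hL : ∀ ω, ⟪X ω, S.integral W ω⟫ = ∑ i ∈ Finset.range S.N, ∑ k, ∑ j,
      X ω k * (S.h i ω (k, j) * incr W j (S.τ i) (S.τ (i + 1)) ω) := by
    intro ω
    rw [S.integral_eq, inner_sum]
    refine Finset.sum_congr rfl fun i _ => ?_
    rw [PiLp.inner_apply]
    refine Finset.sum_congr rfl fun k _ => ?_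
    simp only [Mat.mulVec, RCLike.inner_apply, conj_trivial]
    rw [mul_comm, Finset.mul_sum]
  have mem : ∀ i k j, Integrable (fun ω =>
      X ω k * (S.h i ω (k, j) * incr W j (S.τ i) (S.τ (i + 1)) ω)) P := fun i k j =>
    (hX2.eval_piLp k).integrable_mul (memLp_mul_incr hW
      (((mc i (k, j)).mono ((brownianFiltration hW).le _) le_rfl).aestronglyMeasurable)
      (fun ω => (norm_apply_le _ _).trans (hC i ω)) j _ _)
  simp_rw [hL]
  rw [integral_finsetSum _ fun i _ => integrable_finsetSum _ fun k _ =>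
    integrable_finsetSum _ fun j _ => mem i k j]
  refine Finset.sum_eq_zero fun i _ => ?_
  rw [integral_finsetSum _ fun k _ => integrable_finsetSum _ fun j _ => mem i k j]
  refine Finset.sum_eq_zero fun k _ => ?_
  rw [integral_finsetSum _ fun j _ => mem i k j]
  refine Finset.sum_eq_zero fun j _ => ?_
  have := integral_mul_incr hW (ha.trans (lower i)) (S.mono (Nat.le_succ i))
    (f := fun ω => X ω k * S.h i ω (k, j))
    (((mX k).mono ((brownianFiltration hW).mono (lower i)) le_rfl).mul (mc i (k, j))) j
  simpa only [mul_assoc] using this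

end Simple

section ItoIntegral

variable {Ω : Type*} {mΩ : MeasurableSpace Ω} {P : Measure Ω} [IsProbabilityMeasure P] {d n : ℕ}
  {W : Fin d → ℝ≥0 → Ω → ℝ} {hW : IsBrownianMotion W P} {a b : ℝ}

/-- The polarized Itô isometry. -/
theorem IsItoIntegral.integral_inner {H K : ℝ → Ω → Mat n d} {ξ ζ : Ω → Vec n} (ha : 0 ≤ a)
    (hξ : IsItoIntegral W (brownianFiltration hW) P a b H ξ)
    (hζ : IsItoIntegral W (brownianFiltration hW) P a b K ζ) :
    ∫ ω, ⟪ξ ω, ζ ω⟫ ∂P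
      = ∫ p : ℝ × Ω, ⟪H p.1 p.2, K p.1 p.2⟫ ∂((volume.restrict (Icc a b)).prod P) := by
  obtain ⟨hH, hξ2, S, hS, hSξ⟩ := hξ
  obtain ⟨hK, hζ2, R, hR, hRζ⟩ := hζ
  have h1 := tendsto_integral_inner hξ2 hζ2 (fun k => (S k).memLp_integral hW)
    (fun k => (R k).memLp_integral hW) hSξ hRζ
  have h2 := tendsto_integral_inner hH hK (fun k => (S k).memLp_eval)
    (fun k => (R k).memLp_eval) hS hR
  simp_rw [fun k => (S k).integral_inner_integral hW ha (R k)] at h1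
  exact tendsto_nhds_unique h1 h2

/-- A stochastic integral over `[a, b]` is orthogonal to the `ℱ a`-measurable vectors. -/
theorem IsItoIntegral.integral_inner_eq_zero {H : ℝ → Ω → Mat n d} {ξ X : Ω → Vec n}
    (ha : 0 ≤ a) (hξ : IsItoIntegral W (brownianFiltration hW) P a b H ξ)
    (hX : StronglyMeasurable[brownianFiltration hW a] X) (hX2 : MemLp X 2 P) :
    ∫ ω, ⟪X ω, ξ ω⟫ ∂P = 0 := by
  obtain ⟨-, hξ2, S, -, hSξ⟩ := hξ
  have h1 := tendsto_integral_inner hX2 hξ2 (fun _ => hX2) (fun k => (S k).memLp_integral hW)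
    (by simp) hSξ
  simp_rw [fun k => (S k).integral_inner_eq_zero hW ha hX hX2] at h1
  exact tendsto_nhds_unique h1 tendsto_const_nhds

end ItoIntegral

/-! ### Delay operators and their advanced adjoints -/

section Shift

theorem integral_comp_of_measurePreserving {α β E : Type*} {mα : MeasurableSpace α}
    {mβ : MeasurableSpace β} [NormedAddCommGroup E] [NormedSpace ℝ E] {μ : Measure α}
    {ν : Measure β} {f : α → β} (hf : MeasurePreserving f μ ν) {g : β → E}
    (hg : AEStronglyMeasurable g ν) : ∫ x, g (f x) ∂μ = ∫ y, g y ∂ν := by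
  rw [← hf.map_eq, integral_map hf.measurable.aemeasurable]
  rwa [hf.map_eq]

variable {S : Type*} {mS : MeasurableSpace S} {ν : Measure S} [SFinite ν] {lam : Measure ℝ}
  [SFinite lam] {θ : ℝ → S → S}

/-- A measurable family of measure preserving maps `θ r` gives a measure preserving skew product. -/
theorem measurePreserving_skew (hθ : Measurable (fun p : S × ℝ => θ p.2 p.1))
    (hθν : ∀ r, MeasurePreserving (θ r) ν ν) :
    MeasurePreserving (fun p : S × ℝ => (θ p.2 p.1, p.2)) (ν.prod lam) (ν.prod lam) := by
  have h1 : MeasurePreserving (fun p : ℝ × S => (p.1, θ p.1 p.2)) (lam.prod ν) (lam.prod ν) :=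
    (MeasurePreserving.id lam).skew_product (g := θ) (hθ.comp measurable_swap)
      (ae_of_all _ fun r => (hθν r).map_eq)
  exact (Measure.measurePreserving_swap.comp h1).comp Measure.measurePreserving_swap

/-- A property that holds almost everywhere holds along almost all shifts of almost every point. -/
theorem ae_ae_shift (hθ : Measurable (fun p : S × ℝ => θ p.2 p.1))
    (hθν : ∀ r, MeasurePreserving (θ r) ν ν) {p : S → Prop} (hp : ∀ᵐ s ∂ν, p s) :
    ∀ᵐ s ∂ν, ∀ᵐ r ∂lam, p (θ r s) := by
  have h1 : Measure.QuasiMeasurePreserving (Prod.fst : S × ℝ → S) (ν.prod lam) ν :=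
    Measure.quasiMeasurePreserving_fst
  have h2 := (measurePreserving_skew (lam := lam) hθ hθν).quasiMeasurePreserving.ae (h1.ae hp)
  exact Measure.ae_ae_of_ae_prod h2

variable {E H : Type*} [NormedAddCommGroup E] [InnerProductSpace ℝ E]
  [NormedAddCommGroup H] [InnerProductSpace ℝ H]

/-- Change of variables in a delay pairing: if `y (θ r s) r = x s`, then the pairing of `a` with the
delayed process `y` equals the pairing of the advanced average of `a` with `x`. -/
theorem integral_inner_shift [CompleteSpace E] (hθ : Measurable (fun p : S × ℝ => θ p.2 p.1))
    (hθν : ∀ r, MeasurePreserving (θ r) ν ν) {a y : S → ℝ → E} {x : S → E}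
    (hy : ∀ s r, y (θ r s) r = x s)
    (h1 : Integrable (fun p : S × ℝ => ⟪a p.1 p.2, y p.1 p.2⟫) (ν.prod lam))
    (h2 : Integrable (fun p : S × ℝ => a p.1 p.2) (ν.prod lam)) :
    Integrable (fun s => ∫ r, a (θ r s) r ∂lam) ν ∧
    Integrable (fun s => ⟪x s, ∫ r, a (θ r s) r ∂lam⟫) ν ∧
    ∫ s, ⟪x s, ∫ r, a (θ r s) r ∂lam⟫ ∂ν = ∫ p, ⟪a p.1 p.2, y p.1 p.2⟫ ∂(ν.prod lam) := by
  have hΘ := measurePreserving_skew (lam := lam) hθ hθν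
  have h2' : Integrable (fun p : S × ℝ => a (θ p.2 p.1) p.2) (ν.prod lam) :=
    hΘ.integrable_comp_of_integrable h2
  have h1' : Integrable (fun p : S × ℝ => ⟪x p.1, a (θ p.2 p.1) p.2⟫) (ν.prod lam) := by
    refine (hΘ.integrable_comp_of_integrable h1).congr (ae_of_all _ fun p => ?_)
    simp only [Function.comp, hy]
    rw [real_inner_comm]
  have hin : ∀ᵐ s ∂ν, ∫ r, ⟪x s, a (θ r s) r⟫ ∂lam = ⟪x s, ∫ r, a (θ r s) r ∂lam⟫ := by
    filter_upwards [h2'.prod_right_ae] with s hs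
    exact integral_inner hs (x s)
  refine ⟨h2'.integral_prod_left, h1'.integral_prod_left.congr hin, ?_⟩
  rw [← integral_congr_ae hin, ← integral_prod _ h1',
    ← integral_comp_of_measurePreserving hΘ h1.aestronglyMeasurable]
  refine integral_congr_ae (ae_of_all _ fun p => ?_)
  simp only [hy]
  rw [real_inner_comm]

/-- Duality between a delay operator with random density `A` and the corresponding advanced
operator with density the adjoint of `A`. The set `D` confines the pairing to the time domain. -/
theorem integral_inner_delay [CompleteSpace E] [CompleteSpace H]
    (hθ : Measurable (fun p : S × ℝ => θ p.2 p.1))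
    (hθν : ∀ r, MeasurePreserving (θ r) ν ν) {A : S → ℝ → (E →L[ℝ] H)} {V : S → H} {D : Set S}
    {x : S → E} {y : S → ℝ → E} (hy : ∀ s r, y (θ r s) r = x s)
    (hA : StronglyMeasurable (fun p : S × ℝ => A p.1 p.2)) (hV : StronglyMeasurable V)
    (hD : MeasurableSet D) (hym : StronglyMeasurable (fun p : S × ℝ => y p.1 p.2)) {C : ℝ≥0}
    (hC : ∀ s ∈ D, ∫⁻ r, ‖A s r‖ₑ ∂lam ≤ C) (hVi : IntegrableOn V D ν)
    (hAy : ∫⁻ s in D, ∫⁻ r, ‖⟪A s r (y s r), V s⟫‖ₑ ∂lam ∂ν < ∞)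
    (hAyi : ∀ᵐ s ∂(ν.restrict D), Integrable (fun r => A s r (y s r)) lam) :
    Integrable (fun s => ∫ r, D.indicator
      (fun s' => ContinuousLinearMap.adjoint (A s' r) (V s')) (θ r s) ∂lam) ν ∧
    Integrable (fun s => ⟪x s, ∫ r, D.indicator
      (fun s' => ContinuousLinearMap.adjoint (A s' r) (V s')) (θ r s) ∂lam⟫) ν ∧
    ∫ s, ⟪x s, ∫ r, D.indicator
      (fun s' => ContinuousLinearMap.adjoint (A s' r) (V s')) (θ r s) ∂lam⟫ ∂ν
      = ∫ s in D, ⟪∫ r, A s r (y s r) ∂lam, V s⟫ ∂ν := by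
  have hDS : MeasurableSet ((Prod.fst : S × ℝ → S) ⁻¹' D) := measurable_fst hD
  have hVm : StronglyMeasurable (fun p : S × ℝ => V p.1) := hV.comp_measurable measurable_fst
  -- the density of the advanced operator
  have ham : StronglyMeasurable (fun p : S × ℝ =>
      ContinuousLinearMap.adjoint (A p.1 p.2) (V p.1)) := by
    have h := (ContinuousLinearMap.adjoint (𝕜 := ℝ) (E := E)
      (F := H)).continuous.comp_stronglyMeasurable hA
    exact isBoundedBilinearMap_apply.continuous.comp_stronglyMeasurable (h.prodMk hVm)
  have hAym : StronglyMeasurable (fun p : S × ℝ => A p.1 p.2 (y p.1 p.2)) :=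
    isBoundedBilinearMap_apply.continuous.comp_stronglyMeasurable (hA.prodMk hym)
  have haeq : ∀ r, (fun s => D.indicator
      (fun s' => ContinuousLinearMap.adjoint (A s' r) (V s')) s) = fun s =>
      ((Prod.fst : S × ℝ → S) ⁻¹' D).indicator (fun p : S × ℝ =>
        ContinuousLinearMap.adjoint (A p.1 p.2) (V p.1)) (s, r) := by
    intro r; rfl
  have hrestr : (ν.prod lam).restrict ((Prod.fst : S × ℝ → S) ⁻¹' D)
      = (ν.restrict D).prod lam := by
    conv_rhs => rw [← Measure.restrict_univ (μ := lam)]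
    rw [Measure.prod_restrict, prod_univ]
  have hinner : ∀ p : S × ℝ, ⟪D.indicator
      (fun s' => ContinuousLinearMap.adjoint (A s' p.2) (V s')) p.1, y p.1 p.2⟫
      = ((Prod.fst : S × ℝ → S) ⁻¹' D).indicator
        (fun p : S × ℝ => ⟪A p.1 p.2 (y p.1 p.2), V p.1⟫) p := by
    intro p
    by_cases hp : p.1 ∈ D
    · simp only [indicator, hp, if_true, mem_preimage]
      rw [ContinuousLinearMap.adjoint_inner_left, real_inner_comm]
    · simp [indicator, hp]
  have hi1 : Integrable (fun p : S × ℝ => ⟪A p.1 p.2 (y p.1 p.2), V p.1⟫)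
      ((ν.restrict D).prod lam) := by
    refine ⟨(hAym.inner hVm).aestronglyMeasurable, ?_⟩
    rw [hasFiniteIntegral_iff_enorm, lintegral_prod _ (hAym.inner hVm).enorm.aemeasurable]
    exact hAy
  -- the advanced density is integrable because the total variation of `A` is bounded on `D`,
  -- although `A` itself may be unbounded
  have hi2 : Integrable (fun p : S × ℝ => ContinuousLinearMap.adjoint (A p.1 p.2) (V p.1))
      ((ν.restrict D).prod lam) := by
    refine ⟨ham.aestronglyMeasurable, ?_⟩
    rw [hasFiniteIntegral_iff_enorm, lintegral_prod _ ham.enorm.aemeasurable]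
    calc ∫⁻ s in D, ∫⁻ r, ‖ContinuousLinearMap.adjoint (A s r) (V s)‖ₑ ∂lam ∂ν
        ≤ ∫⁻ s in D, C * ‖V s‖ₑ ∂ν := by
          refine lintegral_mono_ae ?_
          filter_upwards [ae_restrict_mem hD] with s hs
          calc ∫⁻ r, ‖ContinuousLinearMap.adjoint (A s r) (V s)‖ₑ ∂lam
              ≤ ∫⁻ r, ‖A s r‖ₑ * ‖V s‖ₑ ∂lam := by
                refine lintegral_mono fun r => ?_
                refine (ContinuousLinearMap.le_opENorm _ _).trans_eq ?_
                congr 1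
                rw [enorm_eq_iff_norm_eq]
                exact LinearIsometryEquiv.norm_map _ _
            _ = (∫⁻ r, ‖A s r‖ₑ ∂lam) * ‖V s‖ₑ := by
                refine lintegral_mul_const _ ?_
                exact (hA.comp_measurable measurable_prodMk_left).enorm
            _ ≤ C * ‖V s‖ₑ := by gcongr; exact hC s hs
      _ = C * ∫⁻ s in D, ‖V s‖ₑ ∂ν := lintegral_const_mul _ hV.enorm
      _ < ∞ := ENNReal.mul_lt_top ENNReal.coe_lt_top hVi.2
  have hj1 : Integrable (fun p : S × ℝ => ⟪D.indicator
      (fun s' => ContinuousLinearMap.adjoint (A s' p.2) (V s')) p.1, y p.1 p.2⟫)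
      (ν.prod lam) := by
    simp_rw [hinner]
    rw [integrable_indicator_iff hDS, IntegrableOn, hrestr]
    exact hi1
  have hj2 : Integrable (fun p : S × ℝ => D.indicator
      (fun s' => ContinuousLinearMap.adjoint (A s' p.2) (V s')) p.1) (ν.prod lam) := by
    have : (fun p : S × ℝ => D.indicator
      (fun s' => ContinuousLinearMap.adjoint (A s' p.2) (V s')) p.1) =
      ((Prod.fst : S × ℝ → S) ⁻¹' D).indicator (fun p : S × ℝ =>
        ContinuousLinearMap.adjoint (A p.1 p.2) (V p.1)) := by
      ext1 p; exact congrFun (haeq p.2) p.1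
    rw [this, integrable_indicator_iff hDS, IntegrableOn, hrestr]
    exact hi2
  obtain ⟨c1, c2, c3⟩ := integral_inner_shift hθ hθν (a := fun s r => D.indicator
      (fun s' => ContinuousLinearMap.adjoint (A s' r) (V s')) s) hy hj1 hj2
  refine ⟨c1, c2, c3.trans ?_⟩
  simp_rw [hinner]
  rw [integral_indicator hDS, hrestr, integral_prod _ hi1]
  refine integral_congr_ae ?_
  filter_upwards [hAyi] with s hs
  simp_rw [real_inner_comm (V s)]
  exact integral_inner hs (V s)

end Shift

/-! ### The equations at a fixed time, paired with a random vector -/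

section Pairing

variable {Ω : Type*} {mΩ : MeasurableSpace Ω} {P : Measure Ω}

theorem condExp_inner_left {E : Type*} [NormedAddCommGroup E] [InnerProductSpace ℝ E]
    [CompleteSpace E] {m : MeasurableSpace Ω} {X f : Ω → E} (hX : StronglyMeasurable[m] X)
    (hXf : Integrable (fun ω => ⟪X ω, f ω⟫) P) (hf : Integrable f P) :
    P[fun ω => ⟪X ω, f ω⟫ | m] =ᵐ[P] fun ω => ⟪X ω, (P[f | m]) ω⟫ :=
  condExp_bilin_of_stronglyMeasurable_left (innerSL ℝ) hX hXf hf

theorem integral_norm_condExp_le {E : Type*} [NormedAddCommGroup E] [NormedSpace ℝ E]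
    [CompleteSpace E] {m : MeasurableSpace Ω} {f : Ω → E} (hf : Integrable f P) :
    ∫ ω, ‖(P[f | m]) ω‖ ∂P ≤ ∫ ω, ‖f ω‖ ∂P := by
  have h := eLpNorm_condExp_le_eLpNorm (μ := P) (m := m) f (p := 1) le_rfl
  rw [eLpNorm_one_eq_lintegral_enorm, eLpNorm_one_eq_lintegral_enorm] at h
  rw [integral_norm_eq_lintegral_enorm integrable_condExp.aestronglyMeasurable,
    integral_norm_eq_lintegral_enorm hf.aestronglyMeasurable]
  exact ENNReal.toReal_mono hf.2.ne h

variable [IsProbabilityMeasure P] {d n : ℕ} {W : Fin d → ℝ≥0 → Ω → ℝ}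
  {hW : IsBrownianMotion W P}

/-- Integrability on a product from a comparison of the `L¹` norms of the slices. No pointwise
bound is available for slices that are conditional expectations. -/
theorem integrable_of_prod_slices {E : Type*} [NormedAddCommGroup E] {μ : Measure ℝ} [SFinite μ]
    {f : ℝ × Ω → E} {F : Type*} [NormedAddCommGroup F] {h : ℝ × Ω → F}
    (hf : AEStronglyMeasurable f (μ.prod P)) (hh : Integrable h (μ.prod P))
    (hle : ∀ᵐ s ∂μ, Integrable (fun ω => f (s, ω)) P ∧
      ∫ ω, ‖f (s, ω)‖ ∂P ≤ ∫ ω, ‖h (s, ω)‖ ∂P) : Integrable f (μ.prod P) := by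
  rw [integrable_prod_iff hf]
  refine ⟨hle.mono fun s hs => hs.1, ?_⟩
  refine hh.integral_norm_prod_left.mono' hf.norm.integral_prod_right' ?_
  filter_upwards [hle] with s hs
  rw [Real.norm_of_nonneg (integral_nonneg fun ω => norm_nonneg _)]
  exact hs.2

/-- The backward equation at time `t`, paired with an `ℱ t`-measurable vector `X`. The free term
of the equation is `ℓ`, its neutral term `E_t[g]`, and its driver `E_s[f s]`. -/
theorem integral_inner_backward {t T : ℝ} (ht : 0 ≤ t) (htT : t ≤ T)
    {X Yt ℓ g : Ω → Vec n} {f η : ℝ → Ω → Vec n} {Zt : ℝ → Ω → Mat n d}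
    (hX : StronglyMeasurable[brownianFiltration hW t] X) (hX2 : MemLp X 2 P)
    (hY2 : MemLp Yt 2 P) (hXl : Integrable (fun ω => ⟪X ω, ℓ ω⟫) P)
    (hg : Integrable g P) (hXg : Integrable (fun ω => ⟪X ω, g ω⟫) P)
    (hf : Integrable (fun p : ℝ × Ω => f p.1 p.2) ((volume.restrict (Icc t T)).prod P))
    (hXf : Integrable (fun p : ℝ × Ω => ⟪X p.2, f p.1 p.2⟫) ((volume.restrict (Icc t T)).prod P))
    (hηm : StronglyMeasurable (fun p : ℝ × Ω => η p.1 p.2))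
    (hη : ∀ᵐ s ∂(volume.restrict (Icc t T)), η s =ᵐ[P] P[f s | brownianFiltration hW s])
    (hito : IsItoIntegral W (brownianFiltration hW) P t T Zt
      (fun ω => ℓ ω + (∫ s in t..T, η s ω) - (Yt ω - (P[g | brownianFiltration hW t]) ω))) :
    ∫ ω, ⟪X ω, Yt ω⟫ ∂P = ∫ ω, ⟪X ω, ℓ ω⟫ ∂P + ∫ ω, ⟪X ω, g ω⟫ ∂P
      + ∫ p : ℝ × Ω, ⟪X p.2, f p.1 p.2⟫ ∂((volume.restrict (Icc t T)).prod P) := by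
  set μ : Measure ℝ := volume.restrict (Icc t T)
  have hle := (brownianFiltration hW).le
  have hXm : StronglyMeasurable X := hX.mono (hle t)
  have hXp : StronglyMeasurable (fun p : ℝ × Ω => X p.2) := hXm.comp_measurable measurable_snd
  -- conditioning at time `s` does not change the pairing with `X`
  have hs : ∀ᵐ s ∂μ, (Integrable (η s) P ∧ ∫ ω, ‖η s ω‖ ∂P ≤ ∫ ω, ‖f s ω‖ ∂P) ∧
      (Integrable (fun ω => ⟪X ω, η s ω⟫) P ∧
        ∫ ω, ‖⟪X ω, η s ω⟫‖ ∂P ≤ ∫ ω, ‖⟪X ω, f s ω⟫‖ ∂P) ∧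
      ∫ ω, ⟪X ω, η s ω⟫ ∂P = ∫ ω, ⟪X ω, f s ω⟫ ∂P := by
    filter_upwards [hη, hf.prod_right_ae, hXf.prod_right_ae,
      ae_restrict_mem measurableSet_Icc] with s h1 h2 h3 hst
    have h4 := condExp_inner_left (hX.mono ((brownianFiltration hW).mono hst.1)) h3 h2
    have h5 : P[fun ω => ⟪X ω, f s ω⟫ | brownianFiltration hW s]
        =ᵐ[P] fun ω => ⟪X ω, η s ω⟫ := by
      refine h4.trans ?_
      filter_upwards [h1] with ω hω
      rw [hω]
    refine ⟨⟨integrable_condExp.congr h1.symm, ?_⟩, ⟨integrable_condExp.congr h5, ?_⟩, ?_⟩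
    · rw [integral_congr_ae (h1.mono fun ω hω => congrArg norm hω)]
      exact integral_norm_condExp_le h2
    · rw [← integral_congr_ae (h5.mono fun ω hω => congrArg norm hω)]
      exact integral_norm_condExp_le h3
    · rw [← integral_congr_ae h5, integral_condExp (hle s)]
  have hηi : Integrable (fun p : ℝ × Ω => η p.1 p.2) (μ.prod P) :=
    integrable_of_prod_slices hηm.aestronglyMeasurable hf (hs.mono fun s h => h.1)
  have hXη : Integrable (fun p : ℝ × Ω => ⟪X p.2, η p.1 p.2⟫) (μ.prod P) :=
    integrable_of_prod_slices (hXp.inner hηm).aestronglyMeasurable hXf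
      (hs.mono fun s h => h.2.1)
  have hinner : ∀ᵐ ω ∂P, ∫ s, ⟪X ω, η s ω⟫ ∂μ = ⟪X ω, ∫ s in t..T, η s ω⟫ := by
    filter_upwards [hηi.prod_left_ae] with ω hω
    rw [intervalIntegral.integral_of_le htT, ← integral_Icc_eq_integral_Ioc]
    exact integral_inner hω (X ω)
  have hI : Integrable (fun ω => ⟪X ω, ∫ s in t..T, η s ω⟫) P :=
    hXη.integral_prod_right.congr hinner
  have hIe : ∫ ω, ⟪X ω, ∫ s in t..T, η s ω⟫ ∂P
      = ∫ p : ℝ × Ω, ⟪X p.2, f p.1 p.2⟫ ∂(μ.prod P) := by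
    rw [← integral_congr_ae hinner, ← integral_prod_symm _ hXη, integral_prod _ hXη,
      integral_prod _ hXf]
    exact integral_congr_ae (hs.mono fun s h => h.2.2)
  have hgc := condExp_inner_left hX hXg hg
  have hG : Integrable (fun ω => ⟪X ω, (P[g | brownianFiltration hW t]) ω⟫) P :=
    integrable_condExp.congr hgc
  have hGe : ∫ ω, ⟪X ω, (P[g | brownianFiltration hW t]) ω⟫ ∂P = ∫ ω, ⟪X ω, g ω⟫ ∂P := by
    rw [← integral_congr_ae hgc, integral_condExp (hle t)]
  have hXY := integrable_inner_of_memLp hX2 hY2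
  have h0 := hito.integral_inner_eq_zero ht hX hX2
  simp_rw [inner_sub_right, inner_add_right] at h0
  have k1 : Integrable (fun ω => ⟪X ω, ℓ ω⟫ + ⟪X ω, ∫ s in t..T, η s ω⟫) P := hXl.add hI
  have k2 : Integrable (fun ω => ⟪X ω, Yt ω⟫
    - ⟪X ω, (P[g | brownianFiltration hW t]) ω⟫) P := hXY.sub hG
  rw [integral_sub k1 k2, integral_add hXl hI, integral_sub hXY hG, hIe,
    hGe] at h0
  linarith

/-- The forward equation at time `t`, paired with a random vector `Yt` that is represented by the
integrand `Zt`. The neutral term of the equation is `g`, its drift `β + κ`, its diffusion `σ + c`;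
the process `ρ` collects the terms `κ` and `c`. Square integrability of `ρt` is not needed: the
bound on `E|⟪ρt, Yt⟫|` only involves the other terms, and it is integrable in `t`. -/
theorem integral_inner_forward {t : ℝ} (ht : 0 ≤ t)
    {χt Yt ρt g : Ω → Vec n} {β κ : ℝ → Ω → Vec n} {σ c Zt : ℝ → Ω → Mat n d}
    (hχ : MemLp χt 2 P) (hY : MemLp Yt 2 P) (hg : MemLp g 2 P)
    (hβ : MemLp (fun p : ℝ × Ω => β p.1 p.2) 2 ((volume.restrict (Icc 0 t)).prod P))
    (hκ : MemLp (fun p : ℝ × Ω => κ p.1 p.2) 2 ((volume.restrict (Icc 0 t)).prod P))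
    (hσ : MemLp (fun p : ℝ × Ω => σ p.1 p.2) 2 ((volume.restrict (Icc 0 t)).prod P))
    (hc : MemLp (fun p : ℝ × Ω => c p.1 p.2) 2 ((volume.restrict (Icc 0 t)).prod P))
    (hito : IsItoIntegral W (brownianFiltration hW) P 0 t (fun s ω => σ s ω + c s ω)
      (fun ω => χt ω - g ω - ∫ s in (0 : ℝ)..t, (β s ω + κ s ω)))
    (hρ : IsItoIntegral W (brownianFiltration hW) P 0 t c
      (fun ω => ρt ω - ∫ s in (0 : ℝ)..t, κ s ω))
    (hrep : IsItoIntegral W (brownianFiltration hW) P 0 t Zt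
      (fun ω => Yt ω - ∫ ω', Yt ω' ∂P)) :
    Integrable (fun ω => ⟪ρt ω, Yt ω⟫) P ∧
    ∫ ω, ⟪ρt ω, Yt ω⟫ ∂P = ∫ ω, ⟪χt ω, Yt ω⟫ ∂P - ∫ ω, ⟪g ω, Yt ω⟫ ∂P
      - ∫ p : ℝ × Ω, ⟪β p.1 p.2, Yt p.2⟫ ∂((volume.restrict (Icc 0 t)).prod P)
      - ∫ p : ℝ × Ω, ⟪σ p.1 p.2, Zt p.1 p.2⟫ ∂((volume.restrict (Icc 0 t)).prod P) ∧
    ∫ ω, ‖⟪ρt ω, Yt ω⟫‖ ∂P ≤ ∫ ω, ‖⟪χt ω, Yt ω⟫‖ ∂P + ∫ ω, ‖⟪g ω, Yt ω⟫‖ ∂P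
      + ∫ p : ℝ × Ω, ‖⟪β p.1 p.2, Yt p.2⟫‖ ∂((volume.restrict (Icc 0 t)).prod P)
      + (∫ p : ℝ × Ω, ‖σ p.1 p.2‖ ^ 2 ∂((volume.restrict (Icc 0 t)).prod P)
        + ∫ ω, ‖Yt ω‖ ^ 2 ∂P) := by
  set μ : Measure ℝ := volume.restrict (Icc 0 t)
  set ξ : Ω → Vec n := fun ω => χt ω - g ω - ∫ s in (0 : ℝ)..t, (β s ω + κ s ω)
  set ζ : Ω → Vec n := fun ω => ρt ω - ∫ s in (0 : ℝ)..t, κ s ω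
  have hξ2 : MemLp ξ 2 P := hito.2.1
  have hζ2 : MemLp ζ 2 P := hρ.2.1
  have hM2 : MemLp (fun ω => ξ ω - ζ ω) 2 P := hξ2.sub hζ2
  have hYp : MemLp (fun p : ℝ × Ω => Yt p.2) 2 (μ.prod P) := hY.comp_snd μ
  have hβY := integrable_inner_of_memLp hβ hYp
  have hβi := hβ.integrable one_le_two
  have hκi := hκ.integrable one_le_two
  have hIβ : ∀ᵐ ω ∂P, ∫ s, ⟪β s ω, Yt ω⟫ ∂μ = ⟪∫ s in (0 : ℝ)..t, β s ω, Yt ω⟫ := by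
    filter_upwards [hβi.prod_left_ae] with ω hω
    rw [intervalIntegral.integral_of_le ht, ← integral_Icc_eq_integral_Ioc]
    simp_rw [real_inner_comm (Yt ω)]
    exact integral_inner hω (Yt ω)
  have hβYi : Integrable (fun ω => ⟪∫ s in (0 : ℝ)..t, β s ω, Yt ω⟫) P :=
    hβY.integral_prod_right.congr hIβ
  have hβYe : ∫ ω, ⟪∫ s in (0 : ℝ)..t, β s ω, Yt ω⟫ ∂P
      = ∫ p : ℝ × Ω, ⟪β p.1 p.2, Yt p.2⟫ ∂(μ.prod P) := by
    rw [← integral_congr_ae hIβ, ← integral_prod_symm _ hβY]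
  have hχY := integrable_inner_of_memLp hχ hY
  have hgY := integrable_inner_of_memLp hg hY
  have hMY := integrable_inner_of_memLp hM2 hY
  -- eliminate the control terms between the forward equation and the definition of `ρ`
  have hρeq : ∀ᵐ ω ∂P, ⟪ρt ω, Yt ω⟫ = ⟪χt ω, Yt ω⟫ - ⟪g ω, Yt ω⟫
      - ⟪∫ s in (0 : ℝ)..t, β s ω, Yt ω⟫ - ⟪ξ ω - ζ ω, Yt ω⟫ := by
    filter_upwards [hβi.prod_left_ae, hκi.prod_left_ae] with ω h1 h2
    have hadd : ∫ s in (0 : ℝ)..t, (β s ω + κ s ω)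
        = (∫ s in (0 : ℝ)..t, β s ω) + ∫ s in (0 : ℝ)..t, κ s ω := by
      simp_rw [intervalIntegral.integral_of_le ht, ← integral_Icc_eq_integral_Ioc]
      exact integral_add h1 h2
    rw [← inner_sub_left, ← inner_sub_left, ← inner_sub_left]
    congr 1
    simp only [ξ, ζ, hadd]
    abel
  have hρi : Integrable (fun ω => ⟪ρt ω, Yt ω⟫) P :=
    (((hχY.sub hgY).sub hβYi).sub hMY).congr (hρeq.mono fun ω h => h.symm)
  -- the isometry, applied to the two stochastic integrals
  have hσZ := integrable_inner_of_memLp hσ hrep.1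
  have hcZ := integrable_inner_of_memLp hc hrep.1
  have hmean : ∀ X : Ω → Vec n, MemLp X 2 P →
      ∀ {H : ℝ → Ω → Mat n d}, IsItoIntegral W (brownianFiltration hW) P 0 t H X →
      ∫ ω, ⟪X ω, Yt ω⟫ ∂P = ∫ p : ℝ × Ω, ⟪H p.1 p.2, Zt p.1 p.2⟫ ∂(μ.prod P) := by
    intro X hX2 H hX
    have h1 := hX.integral_inner le_rfl hrep
    have h2 := hX.integral_inner_eq_zero le_rfl (X := fun _ => ∫ ω', Yt ω' ∂P)
      stronglyMeasurable_const (memLp_const _)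
    have hXY := integrable_inner_of_memLp hX2 hY
    have hXc := integrable_inner_of_memLp hX2 (memLp_const (∫ ω', Yt ω' ∂P) (μ := P) (p := 2))
    simp_rw [inner_sub_right] at h1
    rw [integral_sub hXY hXc] at h1
    simp_rw [real_inner_comm _ (∫ ω', Yt ω' ∂P)] at h2
    linarith
  have hMe : ∫ ω, ⟪ξ ω - ζ ω, Yt ω⟫ ∂P
      = ∫ p : ℝ × Ω, ⟪σ p.1 p.2, Zt p.1 p.2⟫ ∂(μ.prod P) := by
    simp_rw [inner_sub_left]
    rw [integral_sub (integrable_inner_of_memLp hξ2 hY) (integrable_inner_of_memLp hζ2 hY),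
      hmean ξ hξ2 hito, hmean ζ hζ2 hρ]
    simp_rw [inner_add_left]
    rw [integral_add hσZ hcZ, add_sub_cancel_right]
  refine ⟨hρi, ?_, ?_⟩
  · have k1 : Integrable (fun ω => ⟪χt ω, Yt ω⟫ - ⟪g ω, Yt ω⟫) P := hχY.sub hgY
    have k2 : Integrable (fun ω => ⟪χt ω, Yt ω⟫ - ⟪g ω, Yt ω⟫
      - ⟪∫ s in (0 : ℝ)..t, β s ω, Yt ω⟫) P := k1.sub hβYi
    rw [integral_congr_ae hρeq, integral_sub k2 hMY, integral_sub k1 hβYi,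
      integral_sub hχY hgY, hβYe, hMe]
  -- the variance of the difference of the two stochastic integrals
  have hMM : ∫ ω, ‖ξ ω - ζ ω‖ ^ 2 ∂P = ∫ p : ℝ × Ω, ‖σ p.1 p.2‖ ^ 2 ∂(μ.prod P) := by
    have hσc : MemLp (fun p : ℝ × Ω => σ p.1 p.2 + c p.1 p.2) 2 (μ.prod P) := hσ.add hc
    have e1 := hito.integral_inner le_rfl hito
    have e2 := hito.integral_inner le_rfl hρ
    have e3 := hρ.integral_inner le_rfl hρ
    have l1 : ∀ ω, ‖ξ ω - ζ ω‖ ^ 2 = ⟪ξ ω, ξ ω⟫ - 2 * ⟪ξ ω, ζ ω⟫ + ⟪ζ ω, ζ ω⟫ := by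
      intro ω
      rw [norm_sub_sq_real, real_inner_self_eq_norm_sq, real_inner_self_eq_norm_sq]
    have l2 : ∀ p : ℝ × Ω, ‖σ p.1 p.2‖ ^ 2 = ⟪σ p.1 p.2 + c p.1 p.2, σ p.1 p.2 + c p.1 p.2⟫
        - 2 * ⟪σ p.1 p.2 + c p.1 p.2, c p.1 p.2⟫ + ⟪c p.1 p.2, c p.1 p.2⟫ := by
      intro p
      have := norm_sub_sq_real (σ p.1 p.2 + c p.1 p.2) (c p.1 p.2)
      rw [add_sub_cancel_right] at this
      rw [this, real_inner_self_eq_norm_sq, real_inner_self_eq_norm_sq]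
    simp_rw [l1, l2]
    have i1 := integrable_inner_of_memLp hξ2 hξ2
    have i2 := (integrable_inner_of_memLp hξ2 hζ2).const_mul 2
    have i3 := integrable_inner_of_memLp hζ2 hζ2
    have j1 := integrable_inner_of_memLp hσc hσc
    have j2 := (integrable_inner_of_memLp hσc hc).const_mul 2
    have j3 := integrable_inner_of_memLp hc hc
    have k1 : Integrable (fun ω => ⟪ξ ω, ξ ω⟫ - 2 * ⟪ξ ω, ζ ω⟫) P := i1.sub i2
    have k2 : Integrable (fun p : ℝ × Ω => ⟪σ p.1 p.2 + c p.1 p.2, σ p.1 p.2 + c p.1 p.2⟫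
      - 2 * ⟪σ p.1 p.2 + c p.1 p.2, c p.1 p.2⟫) (μ.prod P) := j1.sub j2
    rw [integral_add k1 i3, integral_sub i1 i2, integral_add k2 j3,
      integral_sub j1 j2, integral_const_mul, integral_const_mul]
    rw [e1, e2, e3]
  have hY2i : Integrable (fun ω => ‖Yt ω‖ ^ 2) P := hY.integrable_norm_pow two_ne_zero
  have hM2i : Integrable (fun ω => ‖ξ ω - ζ ω‖ ^ 2) P := hM2.integrable_norm_pow two_ne_zero
  have hMbd : ∫ ω, ‖⟪ξ ω - ζ ω, Yt ω⟫‖ ∂P ≤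
      ∫ p : ℝ × Ω, ‖σ p.1 p.2‖ ^ 2 ∂(μ.prod P) + ∫ ω, ‖Yt ω‖ ^ 2 ∂P := by
    rw [← hMM, ← integral_add hM2i hY2i]
    refine integral_mono hMY.norm (hM2i.add hY2i) fun ω => ?_
    have h1 := norm_inner_le_norm (𝕜 := ℝ) (ξ ω - ζ ω) (Yt ω)
    beta_reduce
    nlinarith [sq_nonneg (‖ξ ω - ζ ω‖ - ‖Yt ω‖), sq_nonneg ‖ξ ω - ζ ω‖, sq_nonneg ‖Yt ω‖]
  have hβbd : ∫ ω, ‖⟪∫ s in (0 : ℝ)..t, β s ω, Yt ω⟫‖ ∂P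
      ≤ ∫ p : ℝ × Ω, ‖⟪β p.1 p.2, Yt p.2⟫‖ ∂(μ.prod P) := by
    rw [integral_prod_symm _ hβY.norm]
    refine integral_mono_ae hβYi.norm hβY.norm.integral_prod_right ?_
    filter_upwards [hIβ] with ω hω
    rw [← hω]
    exact norm_integral_le_integral_norm _
  have hsum : ∫ ω, ‖⟪ρt ω, Yt ω⟫‖ ∂P ≤ ∫ ω, (‖⟪χt ω, Yt ω⟫‖ + ‖⟪g ω, Yt ω⟫‖
      + ‖⟪∫ s in (0 : ℝ)..t, β s ω, Yt ω⟫‖ + ‖⟪ξ ω - ζ ω, Yt ω⟫‖) ∂P := by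
    refine integral_mono_ae hρi.norm (((hχY.norm.add hgY.norm).add hβYi.norm).add hMY.norm) ?_
    filter_upwards [hρeq] with ω hω
    rw [hω]
    refine (norm_sub_le _ _).trans (add_le_add_left ((norm_sub_le _ _).trans
      (add_le_add_left (norm_sub_le _ _) _)) _)
  have k1 : Integrable (fun ω => ‖⟪χt ω, Yt ω⟫‖ + ‖⟪g ω, Yt ω⟫‖) P := hχY.norm.add hgY.norm
  have k2 : Integrable (fun ω => ‖⟪χt ω, Yt ω⟫‖ + ‖⟪g ω, Yt ω⟫‖
    + ‖⟪∫ s in (0 : ℝ)..t, β s ω, Yt ω⟫‖) P := k1.add hβYi.norm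
  rw [integral_add k2 hMY.norm, integral_add k1 hβYi.norm, integral_add hχY.norm hgY.norm] at hsum
  linarith

end Pairing

/-! ### Time shifts and the triangle `0 ≤ t ≤ s ≤ T` -/

section Triangle

variable {Ω : Type*} {mΩ : MeasurableSpace Ω} {P : Measure Ω} [SFinite P]

/-- Interchanging the two times on `ℝ × ℝ × Ω` preserves the product measure. -/
theorem measurePreserving_swap_left (μ ν : Measure ℝ) [SFinite μ] [SFinite ν] :
    MeasurePreserving (fun p : ℝ × ℝ × Ω => (p.2.1, p.1, p.2.2)) (μ.prod (ν.prod P))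
      (ν.prod (μ.prod P)) := by
  have h1 := (measurePreserving_prodAssoc μ ν P).symm
  have h2 : MeasurePreserving (Prod.map Prod.swap id) ((μ.prod ν).prod P) ((ν.prod μ).prod P) :=
    Measure.measurePreserving_swap.prod (MeasurePreserving.id P)
  exact (measurePreserving_prodAssoc ν μ P).comp (h2.comp h1)

theorem measurable_swap_left : Measurable (fun p : ℝ × ℝ × Ω => (p.2.1, p.1, p.2.2)) := by
  fun_prop

/-- The translation of time on `ℝ × Ω`. -/
def timeShift (r : ℝ) (p : ℝ × Ω) : ℝ × Ω := (p.1 + r, p.2)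

/-- The simultaneous translation of both times on `ℝ × ℝ × Ω`. -/
def timeShift₂ (r : ℝ) (p : ℝ × ℝ × Ω) : ℝ × ℝ × Ω := (p.1 + r, p.2.1 + r, p.2.2)

theorem measurable_timeShift : Measurable (fun p : (ℝ × Ω) × ℝ => timeShift p.2 p.1) := by
  unfold timeShift; fun_prop

theorem measurable_timeShift₂ : Measurable (fun p : (ℝ × ℝ × Ω) × ℝ => timeShift₂ p.2 p.1) := by
  unfold timeShift₂; fun_prop

theorem measurePreserving_timeShift (r : ℝ) : MeasurePreserving (timeShift (Ω := Ω) r)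
    ((volume : Measure ℝ).prod P) ((volume : Measure ℝ).prod P) :=
  (measurePreserving_add_right volume r).prod (MeasurePreserving.id P)

theorem measurePreserving_timeShift₂ (r : ℝ) : MeasurePreserving (timeShift₂ (Ω := Ω) r)
    ((volume : Measure ℝ).prod ((volume : Measure ℝ).prod P))
    ((volume : Measure ℝ).prod ((volume : Measure ℝ).prod P)) :=
  (measurePreserving_add_right volume r).prod (measurePreserving_timeShift r)

/-- The time domain `0 ≤ t ≤ s ≤ T` of a pair of times, as a set of triples `(t, s, ω)`. -/
def triangle (Ω : Type*) (T : ℝ) : Set (ℝ × ℝ × Ω) := {p | 0 ≤ p.1 ∧ p.1 ≤ p.2.1 ∧ p.2.1 ≤ T}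

theorem measurableSet_triangle (T : ℝ) : MeasurableSet (triangle Ω T) := by
  refine (measurableSet_le measurable_const measurable_fst).inter
    ((measurableSet_le measurable_fst (measurable_fst.comp measurable_snd)).inter
      (measurableSet_le (measurable_fst.comp measurable_snd) measurable_const))

theorem prod_restrict_left (S : Set ℝ) : ((volume : Measure ℝ).restrict S).prod P
    = ((volume : Measure ℝ).prod P).restrict (S ×ˢ univ) := by
  rw [← Measure.prod_restrict, Measure.restrict_univ]

theorem restrict_triangle_le (T : ℝ) :
    ((volume : Measure ℝ).prod ((volume : Measure ℝ).prod P)).restrict (triangle Ω T)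
      ≤ (volume.restrict (Icc 0 T)).prod ((volume.restrict (Icc 0 T)).prod P) := by
  rw [prod_restrict_left (P := P), Measure.prod_restrict]
  refine Measure.restrict_mono ?_ le_rfl
  rintro ⟨t, s, ω⟩ ⟨h1, h2, h3⟩
  exact ⟨⟨h1, h2.trans h3⟩, ⟨h1.trans h2, h3⟩, trivial⟩

variable {E : Type*} [NormedAddCommGroup E] [NormedSpace ℝ E]

/-- Fubini's theorem on the triangle, with the smaller time as the outer variable. -/
theorem integral_triangle {T : ℝ} {g : ℝ × ℝ × Ω → E} (hg : IntegrableOn g (triangle Ω T)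
    ((volume : Measure ℝ).prod ((volume : Measure ℝ).prod P))) :
    (∀ᵐ t ∂(volume.restrict (Icc 0 T)), Integrable (fun p : ℝ × Ω => g (t, p))
      ((volume.restrict (Icc t T)).prod P)) ∧
    Integrable (fun t => ∫ p, g (t, p) ∂((volume.restrict (Icc t T)).prod P))
      (volume.restrict (Icc 0 T)) ∧
    ∫ p in triangle Ω T, g p ∂((volume : Measure ℝ).prod ((volume : Measure ℝ).prod P))
      = ∫ t in Icc 0 T, ∫ p, g (t, p) ∂((volume.restrict (Icc t T)).prod P) := by
  have hi := (integrable_indicator_iff (measurableSet_triangle T)).2 hg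
  have hms : ∀ t, MeasurableSet (Icc t T ×ˢ (univ : Set Ω)) := fun t =>
    measurableSet_Icc.prod MeasurableSet.univ
  have hsl : ∀ t, (fun p : ℝ × Ω => (triangle Ω T).indicator g (t, p)) =
      (Icc 0 T).indicator (fun t => (Icc t T ×ˢ (univ : Set Ω)).indicator
        (fun p => g (t, p))) t := by
    intro t
    ext1 p
    by_cases ht : t ∈ Icc 0 T
    · rw [indicator_of_mem ht]
      by_cases hp : p.1 ∈ Icc t T
      · rw [indicator_of_mem (show (t, p) ∈ triangle Ω T from ⟨ht.1, hp.1, hp.2⟩),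
          indicator_of_mem (show p ∈ Icc t T ×ˢ (univ : Set Ω) from ⟨hp, trivial⟩)]
      · rw [indicator_of_notMem (fun h : (t, p) ∈ triangle Ω T => hp ⟨h.2.1, h.2.2⟩),
          indicator_of_notMem (fun h : p ∈ Icc t T ×ˢ (univ : Set Ω) => hp h.1)]
    · rw [indicator_of_notMem ht, indicator_of_notMem
        (fun h : (t, p) ∈ triangle Ω T => ht ⟨h.1, h.2.1.trans h.2.2⟩)]
      rfl
  have hin : ∀ t, ∫ p, (triangle Ω T).indicator g (t, p) ∂((volume : Measure ℝ).prod P)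
      = (Icc 0 T).indicator
        (fun t => ∫ p, g (t, p) ∂((volume.restrict (Icc t T)).prod P)) t := by
    intro t
    rw [hsl t]
    by_cases ht : t ∈ Icc 0 T
    · rw [indicator_of_mem ht, indicator_of_mem ht, integral_indicator (hms t),
        ← prod_restrict_left]
    · rw [indicator_of_notMem ht, indicator_of_notMem ht]; simp
  refine ⟨?_, ?_, ?_⟩
  · rw [ae_restrict_iff' measurableSet_Icc]
    filter_upwards [hi.prod_right_ae] with t ht ht'
    rw [hsl t, indicator_of_mem ht', integrable_indicator_iff (hms t), IntegrableOn,
      ← prod_restrict_left] at ht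
    exact ht
  · have h := hi.integral_prod_left
    simp_rw [hin] at h
    exact (integrable_indicator_iff measurableSet_Icc).1 h
  · rw [← integral_indicator (measurableSet_triangle T), integral_prod _ hi]
    simp_rw [hin]
    rw [integral_indicator measurableSet_Icc]

/-- Fubini's theorem on the triangle, with the larger time as the outer variable. -/
theorem integral_triangle_symm {T : ℝ} {g : ℝ × ℝ × Ω → E} (hg : IntegrableOn g (triangle Ω T)
    ((volume : Measure ℝ).prod ((volume : Measure ℝ).prod P))) :
    Integrable (fun s => ∫ p : ℝ × Ω, g (p.1, s, p.2) ∂((volume.restrict (Icc 0 s)).prod P))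
      (volume.restrict (Icc 0 T)) ∧
    ∫ p in triangle Ω T, g p ∂((volume : Measure ℝ).prod ((volume : Measure ℝ).prod P))
      = ∫ s in Icc 0 T, ∫ p : ℝ × Ω, g (p.1, s, p.2) ∂((volume.restrict (Icc 0 s)).prod P) := by
  have hi := (integrable_indicator_iff (measurableSet_triangle T)).2 hg
  have hsw := measurePreserving_swap_left (P := P) (volume : Measure ℝ) (volume : Measure ℝ)
  have hi' : Integrable (fun p : ℝ × ℝ × Ω => (triangle Ω T).indicator g (p.2.1, p.1, p.2.2))
      ((volume : Measure ℝ).prod ((volume : Measure ℝ).prod P)) :=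
    hsw.integrable_comp_of_integrable hi
  have hms : ∀ s : ℝ, MeasurableSet (Icc 0 s ×ˢ (univ : Set Ω)) := fun t =>
    measurableSet_Icc.prod MeasurableSet.univ
  have hsl : ∀ s, (fun p : ℝ × Ω => (triangle Ω T).indicator g (p.1, s, p.2)) =
      (Icc 0 T).indicator (fun s => (Icc 0 s ×ˢ (univ : Set Ω)).indicator
        (fun p => g (p.1, s, p.2))) s := by
    intro s
    ext1 p
    by_cases hs : s ∈ Icc 0 T
    · rw [indicator_of_mem hs]
      by_cases hp : p.1 ∈ Icc 0 s
      · rw [indicator_of_mem (show (p.1, s, p.2) ∈ triangle Ω T from ⟨hp.1, hp.2, hs.2⟩),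
          indicator_of_mem (show p ∈ Icc 0 s ×ˢ (univ : Set Ω) from ⟨hp, trivial⟩)]
      · rw [indicator_of_notMem (fun h : (p.1, s, p.2) ∈ triangle Ω T => hp ⟨h.1, h.2.1⟩),
          indicator_of_notMem (fun h : p ∈ Icc 0 s ×ˢ (univ : Set Ω) => hp h.1)]
    · rw [indicator_of_notMem hs, indicator_of_notMem
        (fun h : (p.1, s, p.2) ∈ triangle Ω T => hs ⟨h.1.trans h.2.1, h.2.2⟩)]
      rfl
  have hin : ∀ s, ∫ p : ℝ × Ω, (triangle Ω T).indicator g (p.1, s, p.2)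
        ∂((volume : Measure ℝ).prod P)
      = (Icc 0 T).indicator (fun s => ∫ p : ℝ × Ω, g (p.1, s, p.2)
          ∂((volume.restrict (Icc 0 s)).prod P)) s := by
    intro s
    rw [hsl s]
    by_cases hs : s ∈ Icc 0 T
    · rw [indicator_of_mem hs, indicator_of_mem hs, integral_indicator (hms s),
        ← prod_restrict_left]
    · rw [indicator_of_notMem hs, indicator_of_notMem hs]; simp
  refine ⟨?_, ?_⟩
  · have h := hi'.integral_prod_left
    simp_rw [hin] at h
    exact (integrable_indicator_iff measurableSet_Icc).1 h
  · rw [← integral_indicator (measurableSet_triangle T),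
      ← integral_comp_of_measurePreserving hsw hi.aestronglyMeasurable, integral_prod _ hi']
    simp_rw [hin]
    rw [integral_indicator measurableSet_Icc]

theorem ae_swap_left {p : ℝ × Ω → Prop} (h : ∀ᵐ q ∂((volume : Measure ℝ).prod P), p q) :
    ∀ᵐ q ∂((volume : Measure ℝ).prod ((volume : Measure ℝ).prod P)), p (q.1, q.2.2) := by
  have h1 : Measure.QuasiMeasurePreserving (Prod.snd : ℝ × ℝ × Ω → ℝ × Ω)
      ((volume : Measure ℝ).prod ((volume : Measure ℝ).prod P)) ((volume : Measure ℝ).prod P) :=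
    Measure.quasiMeasurePreserving_snd
  exact (measurePreserving_swap_left (P := P) volume volume).quasiMeasurePreserving.ae (h1.ae h)

end Triangle

section Truncation

variable {Ω : Type*} {mΩ : MeasurableSpace Ω} {P : Measure Ω} [IsProbabilityMeasure P]
  {E : Type*} [NormedAddCommGroup E]

/-- The process `χ`, set to zero outside `(0, T]`. The equations control `χ` on a bounded
time interval only, while the substitution `t ↦ t + r` acts on the whole line. -/
def truncate (T : ℝ) (χ : ℝ → Ω → E) (t : ℝ) (ω : Ω) : E :=
  (Ioc 0 T).indicator (fun t => χ t ω) t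

theorem truncate_of_mem {T t : ℝ} (χ : ℝ → Ω → E) (ht : t ∈ Ioc 0 T) :
    truncate T χ t = χ t := by
  ext1 ω; simp [truncate, ht]

theorem truncate_of_notMem {T t : ℝ} (χ : ℝ → Ω → E) (ht : t ∉ Ioc 0 T) (ω : Ω) :
    truncate T χ t ω = 0 := by
  simp [truncate, ht]

theorem stronglyMeasurable_truncate (T : ℝ) {χ : ℝ → Ω → E}
    (hχ : StronglyMeasurable (fun p : ℝ × Ω => χ p.1 p.2)) :
    StronglyMeasurable (fun p : ℝ × Ω => truncate T χ p.1 p.2) := by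
  have h : (fun p : ℝ × Ω => truncate T χ p.1 p.2)
      = ((Prod.fst : ℝ × Ω → ℝ) ⁻¹' (Ioc 0 T)).indicator (fun p => χ p.1 p.2) := by
    ext1 p; simp [truncate, indicator]
  rw [h]
  exact hχ.indicator (measurable_fst measurableSet_Ioc)

/-- Truncation does not change the delayed values of a process that vanishes before time `0`. -/
theorem ae_truncate_sub {T δ : ℝ} {lam : Measure ℝ} [SFinite lam] (hlam : lam (Icc 0 δ)ᶜ = 0)
    {χ : ℝ → Ω → E} (hχ : StronglyMeasurable (fun p : ℝ × Ω => χ p.1 p.2))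
    (h0 : ∀ᵐ t ∂(volume.restrict (Icc (-δ) 0)), ∀ᵐ ω ∂P, χ t ω = 0) :
    ∀ᵐ p ∂((volume : Measure ℝ).prod P), p.1 ∈ Icc 0 T →
      ∀ᵐ r ∂lam, truncate T χ (p.1 - r) p.2 = χ (p.1 - r) p.2 := by
  have h1 : ∀ᵐ p ∂((volume : Measure ℝ).prod P), p.1 ∈ Icc (-δ) 0 → χ p.1 p.2 = 0 := by
    rw [Measure.ae_prod_iff_ae_ae]
    · rw [ae_restrict_iff' measurableSet_Icc] at h0
      filter_upwards [h0] with t ht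
      by_cases htm : t ∈ Icc (-δ) 0
      · exact (ht htm).mono fun ω h _ => h
      · exact ae_of_all _ fun ω h => absurd h htm
    · have hA : MeasurableSet {p : ℝ × Ω | p.1 ∈ Icc (-δ) 0} := measurable_fst measurableSet_Icc
      exact hA.imp (hχ.measurableSet_eq_fun stronglyMeasurable_const)
  have h2 := ae_ae_shift (lam := lam) (θ := fun r => timeShift (Ω := Ω) (-r)) (by
    unfold timeShift; fun_prop) (fun r => measurePreserving_timeShift (P := P) (-r)) h1
  filter_upwards [h2] with p hp hpt
  have hlam' : ∀ᵐ r ∂lam, r ∈ Icc 0 δ := by rw [ae_iff]; exact hlam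
  filter_upwards [hp, hlam'] with r hr hrδ
  simp only [timeShift, ← sub_eq_add_neg] at hr
  by_cases hm : p.1 - r ∈ Ioc 0 T
  · rw [truncate_of_mem χ hm]
  · rw [truncate_of_notMem χ hm, hr]
    have : p.1 - r ≤ T := by linarith [hpt.2, hrδ.1]
    exact ⟨by linarith [hpt.1, hrδ.2], not_lt.1 fun h => hm ⟨h, this⟩⟩

end Truncation

/-! ### Duality of the delay terms -/

section DelayOn

/-- The pairing of a delay integrand with a square integrable `V` converges absolutely if the delay
integral of the norms is square integrable. -/
theorem lintegral_inner_lt_top {S H : Type*} {mS : MeasurableSpace S} {ν : Measure S}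
    {lam : Measure ℝ} [NormedAddCommGroup H] [InnerProductSpace ℝ H] {F : S → ℝ → H} {V : S → H}
    (hF : ∫⁻ s, (∫⁻ r, ‖F s r‖ₑ ∂lam) ^ 2 ∂ν < ∞) (hV : StronglyMeasurable V)
    (hV2 : MemLp V 2 ν) : ∫⁻ s, ∫⁻ r, ‖⟪F s r, V s⟫‖ₑ ∂lam ∂ν < ∞ := by
  have hVfin : ∫⁻ s, ‖V s‖ₑ ^ 2 ∂ν < ∞ := by
    have h := (eLpNorm_lt_top_iff_lintegral_rpow_enorm_lt_top two_ne_zero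
      ENNReal.ofNat_ne_top).1 hV2.2
    simpa using h
  calc ∫⁻ s, ∫⁻ r, ‖⟪F s r, V s⟫‖ₑ ∂lam ∂ν
      ≤ ∫⁻ s, ((∫⁻ r, ‖F s r‖ₑ ∂lam) ^ 2 + ‖V s‖ₑ ^ 2) ∂ν := by
        refine lintegral_mono fun s => ?_
        have h1 : ∫⁻ r, ‖⟪F s r, V s⟫‖ₑ ∂lam ≤ (∫⁻ r, ‖F s r‖ₑ ∂lam) * ‖V s‖ₑ := by
          rw [← lintegral_mul_const' _ _ enorm_ne_top]
          refine lintegral_mono fun r => ?_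
          simp only [← ofReal_norm, ← ENNReal.ofReal_mul (norm_nonneg _)]
          exact ENNReal.ofReal_le_ofReal (norm_inner_le_norm _ _)
        refine h1.trans ?_
        rcases le_total (∫⁻ r, ‖F s r‖ₑ ∂lam) ‖V s‖ₑ with h | h
        · exact (mul_le_mul_left h _).trans (by rw [← sq]; exact le_add_self)
        · exact (mul_le_mul_right h _).trans (by rw [← sq]; exact le_self_add)
    _ = _ := lintegral_add_right _ (hV.enorm.pow_const 2)
    _ < ∞ := ENNReal.add_lt_top.2 ⟨hF, hVfin⟩

variable {S : Type*} {mS : MeasurableSpace S} {ν : Measure S} [SFinite ν] {lam : Measure ℝ}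
  [SFinite lam] {θ : ℝ → S → S} {E H : Type*} [NormedAddCommGroup E] [InnerProductSpace ℝ E]
  [NormedAddCommGroup H] [InnerProductSpace ℝ H] [CompleteSpace E] [CompleteSpace H]

/-- A form of `integral_inner_delay` in which the processes need to be truncated to the time domain
`D` only up to null sets: `x`, `y` are the truncations of the processes `x'`, `y'`. By `hx0` no
point outside `D` contributes to the pairing, either because `x` vanishes there or because
advancing the point does not lead into `D`. -/
theorem setIntegral_inner_delay
    (hθ : Measurable (fun p : S × ℝ => θ p.2 p.1))
    (hθν : ∀ r, MeasurePreserving (θ r) ν ν) {A : S → ℝ → (E →L[ℝ] H)} {V : S → H} {D : Set S}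
    {x x' : S → E} {y y' : S → ℝ → E} (hy : ∀ s r, y (θ r s) r = x s)
    (hA : StronglyMeasurable (fun p : S × ℝ => A p.1 p.2)) (hV : StronglyMeasurable V)
    (hD : MeasurableSet D) (hym : StronglyMeasurable (fun p : S × ℝ => y p.1 p.2)) {C : ℝ≥0}
    (hC : ∀ s ∈ D, ∫⁻ r, ‖A s r‖ₑ ∂lam ≤ C) (hVi : IntegrableOn V D ν)
    (hAy : ∫⁻ s in D, ∫⁻ r, ‖⟪A s r (y' s r), V s⟫‖ₑ ∂lam ∂ν < ∞)
    (hAyi : ∀ᵐ s ∂(ν.restrict D), Integrable (fun r => A s r (y' s r)) lam)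
    (hxx' : ∀ᵐ s ∂(ν.restrict D), x s = x' s)
    (hyy' : ∀ᵐ s ∂(ν.restrict D), ∀ᵐ r ∂lam, y s r = y' s r)
    (hx0 : ∀ s ∉ D, x s = 0 ∨ ∀ᵐ r ∂lam, θ r s ∉ D)
    (hV0 : ∀ᵐ s ∂(ν.restrict D), ∀ᵐ r ∂lam, θ r s ∉ D → V (θ r s) = 0) :
    IntegrableOn (fun s => ∫ r, ContinuousLinearMap.adjoint (A (θ r s) r) (V (θ r s)) ∂lam) D ν ∧
    IntegrableOn (fun s => ⟪x' s,
      ∫ r, ContinuousLinearMap.adjoint (A (θ r s) r) (V (θ r s)) ∂lam⟫) D ν ∧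
    ∫ s in D, ⟪x' s, ∫ r, ContinuousLinearMap.adjoint (A (θ r s) r) (V (θ r s)) ∂lam⟫ ∂ν
      = ∫ s in D, ⟪∫ r, A s r (y' s r) ∂lam, V s⟫ ∂ν := by
  have hAy1 : ∫⁻ s in D, ∫⁻ r, ‖⟪A s r (y s r), V s⟫‖ₑ ∂lam ∂ν < ∞ := by
    refine lt_of_eq_of_lt (lintegral_congr_ae ?_) hAy
    filter_upwards [hyy'] with s hs
    refine lintegral_congr_ae ?_
    filter_upwards [hs] with r hr
    rw [hr]
  have hAyi1 : ∀ᵐ s ∂(ν.restrict D), Integrable (fun r => A s r (y s r)) lam := by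
    filter_upwards [hyy', hAyi] with s hs hi
    refine hi.congr ?_
    filter_upwards [hs] with r hr
    rw [hr]
  obtain ⟨c1, c2, c3⟩ := integral_inner_delay hθ hθν hy hA hV hD hym hC hVi hAy1 hAyi1
  have hb : ∀ᵐ s ∂(ν.restrict D), ∫ r, D.indicator
      (fun s' => ContinuousLinearMap.adjoint (A s' r) (V s')) (θ r s) ∂lam
      = ∫ r, ContinuousLinearMap.adjoint (A (θ r s) r) (V (θ r s)) ∂lam := by
    filter_upwards [hV0] with s hs
    refine integral_congr_ae ?_
    filter_upwards [hs] with r hr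
    by_cases hm : θ r s ∈ D
    · rw [indicator_of_mem hm]
    · rw [indicator_of_notMem hm, hr hm, map_zero]
  have hin : ∀ᵐ s ∂(ν.restrict D), ⟪x s, ∫ r, D.indicator
      (fun s' => ContinuousLinearMap.adjoint (A s' r) (V s')) (θ r s) ∂lam⟫ = ⟪x' s,
      ∫ r, ContinuousLinearMap.adjoint (A (θ r s) r) (V (θ r s)) ∂lam⟫ := by
    filter_upwards [hb, hxx'] with s h1 h2
    rw [h1, h2]
  refine ⟨c1.integrableOn.congr hb, c2.integrableOn.congr hin, ?_⟩
  rw [← integral_congr_ae hin, setIntegral_eq_integral_of_forall_compl_eq_zero, c3]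
  · refine integral_congr_ae ?_
    filter_upwards [hyy'] with s hs
    congr 1
    refine integral_congr_ae ?_
    filter_upwards [hs] with r hr
    rw [hr]
  · intro s hs
    rcases hx0 s hs with h | h
    · rw [h, inner_zero_left]
    · rw [integral_eq_zero_of_ae, inner_zero_right]
      filter_upwards [h] with r hr
      rw [indicator_of_notMem hr, Pi.zero_apply]

end DelayOn

section Delay

variable {Ω : Type*} {mΩ : MeasurableSpace Ω} {P : Measure Ω} {n : ℕ} {H : Type*}
  [NormedAddCommGroup H] [InnerProductSpace ℝ H]
  {ℱ : Filtration ℝ mΩ} {T δ : ℝ} {lam : Measure ℝ} {A : ℝ → Ω → ℝ → (Vec n →L[ℝ] H)}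
  {χ : ℝ → Ω → Vec n}

theorem stronglyMeasurable_delay (hA : IsDelayDensity ℱ T δ lam A)
    (hχ : StronglyMeasurable (fun p : ℝ × Ω => χ p.1 p.2)) :
    StronglyMeasurable (fun p : (ℝ × Ω) × ℝ => A p.1.1 p.1.2 p.2 (χ (p.1.1 - p.2) p.1.2)) := by
  have h1 : StronglyMeasurable (fun p : (ℝ × Ω) × ℝ => A p.1.1 p.1.2 p.2) :=
    hA.measurable.comp_measurable
      (g := fun p : (ℝ × Ω) × ℝ => (p.1.1, p.1.2, p.2)) (by fun_prop)
  have h2 : StronglyMeasurable (fun p : (ℝ × Ω) × ℝ => χ (p.1.1 - p.2) p.1.2) :=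
    hχ.comp_measurable (g := fun p : (ℝ × Ω) × ℝ => (p.1.1 - p.2, p.1.2)) (by fun_prop)
  exact isBoundedBilinearMap_apply.continuous.comp_stronglyMeasurable (h1.prodMk h2)

theorem measurable_lintegral_delay (hA : IsDelayDensity ℱ T δ lam A)
    (hχ : StronglyMeasurable (fun p : ℝ × Ω => χ p.1 p.2)) :
    Measurable (fun p : ℝ × Ω => ∫⁻ r, ‖A p.1 p.2 r (χ (p.1 - r) p.2)‖ₑ ∂lam) := by
  have := hA.prob
  exact (stronglyMeasurable_delay hA hχ).enorm.lintegral_prod_right'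

theorem ae_integrable_delay (hA : IsDelayDensity ℱ T δ lam A)
    (hχ : StronglyMeasurable (fun p : ℝ × Ω => χ p.1 p.2)) (hsq : DelaySqIntegrable P T lam A χ) :
    ∀ᵐ p ∂((volume.restrict (Icc 0 T)).prod P),
      Integrable (fun r => A p.1 p.2 r (χ (p.1 - r) p.2)) lam := by
  filter_upwards [ae_lt_top ((measurable_lintegral_delay hA hχ).pow_const 2) hsq.ne] with p hp
  refine ⟨((stronglyMeasurable_delay hA hχ).comp_measurable
    measurable_prodMk_left).aestronglyMeasurable, ?_⟩
  rw [hasFiniteIntegral_iff_enorm]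
  by_contra h
  rw [not_lt, top_le_iff] at h
  rw [h] at hp
  simp at hp

theorem memLp_delayInt (hA : IsDelayDensity ℱ T δ lam A)
    (hχ : StronglyMeasurable (fun p : ℝ × Ω => χ p.1 p.2)) (hsq : DelaySqIntegrable P T lam A χ) :
    MemLp (fun p : ℝ × Ω => delayInt lam A χ p.1 p.2) 2 ((volume.restrict (Icc 0 T)).prod P) := by
  have := hA.prob
  refine ⟨(stronglyMeasurable_delay hA hχ).integral_prod_right'.aestronglyMeasurable, ?_⟩
  rw [eLpNorm_lt_top_iff_lintegral_rpow_enorm_lt_top two_ne_zero ENNReal.ofNat_ne_top]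
  refine lt_of_le_of_lt (lintegral_mono fun p => ?_) hsq
  simp only [ENNReal.toReal_ofNat, ENNReal.rpow_ofNat]
  gcongr
  exact enorm_integral_le_lintegral_enorm _

variable [IsProbabilityMeasure P] [CompleteSpace H]

/-- The one-time duality between the delay operator with density `A` and its advanced adjoint. -/
theorem setIntegral_inner_delay_time (hA : IsDelayDensity ℱ T δ lam A)
    (hχ : StronglyMeasurable (fun p : ℝ × Ω => χ p.1 p.2))
    (h0 : ∀ᵐ t ∂(volume.restrict (Icc (-δ) 0)), ∀ᵐ ω ∂P, χ t ω = 0)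
    {U : ℝ → Ω → H} (hU : StronglyMeasurable (fun p : ℝ × Ω => U p.1 p.2))
    (hUi : Integrable (fun p : ℝ × Ω => U p.1 p.2) ((volume.restrict (Icc 0 T)).prod P))
    (hU0 : ∀ᵐ p ∂((volume : Measure ℝ).prod P), T < p.1 → p.1 ≤ T + δ → U p.1 p.2 = 0)
    (hAχ : ∫⁻ p, ∫⁻ r, ‖⟪A p.1 p.2 r (χ (p.1 - r) p.2), U p.1 p.2⟫‖ₑ ∂lam
      ∂((volume.restrict (Icc 0 T)).prod P) < ∞)
    (hAχi : ∀ᵐ p ∂((volume.restrict (Icc 0 T)).prod P),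
      Integrable (fun r => A p.1 p.2 r (χ (p.1 - r) p.2)) lam) :
    Integrable (fun p : ℝ × Ω => ∫ r, ContinuousLinearMap.adjoint (A (p.1 + r) p.2 r)
      (U (p.1 + r) p.2) ∂lam) ((volume.restrict (Icc 0 T)).prod P) ∧
    Integrable (fun p : ℝ × Ω => ⟪χ p.1 p.2, ∫ r, ContinuousLinearMap.adjoint (A (p.1 + r) p.2 r)
      (U (p.1 + r) p.2) ∂lam⟫) ((volume.restrict (Icc 0 T)).prod P) ∧
    ∫ p, ⟪χ p.1 p.2, ∫ r, ContinuousLinearMap.adjoint (A (p.1 + r) p.2 r)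
      (U (p.1 + r) p.2) ∂lam⟫ ∂((volume.restrict (Icc 0 T)).prod P)
      = ∫ p, ⟪delayInt lam A χ p.1 p.2, U p.1 p.2⟫ ∂((volume.restrict (Icc 0 T)).prod P) := by
  have := hA.prob
  obtain ⟨C, hC⟩ := hA.bounded
  have hlam : ∀ᵐ r ∂lam, r ∈ Icc 0 δ := by rw [ae_iff]; exact hA.support
  have hD : MeasurableSet (Icc (0 : ℝ) T ×ˢ (univ : Set Ω)) :=
    measurableSet_Icc.prod MeasurableSet.univ
  have hne : ∀ᵐ p : ℝ × Ω ∂((volume : Measure ℝ).prod P), p.1 ≠ 0 :=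
    Measure.quasiMeasurePreserving_fst.ae (Measure.ae_ne volume 0)
  have htr := stronglyMeasurable_truncate T hχ
  rw [prod_restrict_left] at hUi hAχ hAχi ⊢
  refine setIntegral_inner_delay (θ := timeShift) (ν := (volume : Measure ℝ).prod P)
    (A := fun p r => A p.1 p.2 r) (V := fun p => U p.1 p.2) (D := Icc 0 T ×ˢ univ)
    (x := fun p => truncate T χ p.1 p.2) (x' := fun p => χ p.1 p.2)
    (y := fun p r => truncate T χ (p.1 - r) p.2) (y' := fun p r => χ (p.1 - r) p.2)
    measurable_timeShift measurePreserving_timeShift ?_ ?_ hU hD ?_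
    (C := C) (fun p hp => hC p.1 hp.1 p.2) hUi hAχ hAχi ?_ ?_ ?_ ?_
  · intro p r; simp [timeShift]
  · exact hA.measurable.comp_measurable
      (g := fun p : (ℝ × Ω) × ℝ => (p.1.1, p.1.2, p.2)) (by fun_prop)
  · exact htr.comp_measurable (g := fun p : (ℝ × Ω) × ℝ => (p.1.1 - p.2, p.1.2)) (by fun_prop)
  · rw [ae_restrict_iff' hD]
    filter_upwards [hne] with p hp hpD
    rw [truncate_of_mem χ ⟨lt_of_le_of_ne hpD.1.1 (Ne.symm hp), hpD.1.2⟩]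
  · rw [ae_restrict_iff' hD]
    filter_upwards [ae_truncate_sub (P := P) (T := T) hA.support hχ h0] with p hp hpD
    exact hp hpD.1
  · intro p hp
    refine Or.inl (truncate_of_notMem χ (fun h => hp ⟨⟨h.1.le, h.2⟩, trivial⟩) _)
  · rw [ae_restrict_iff' hD]
    filter_upwards [ae_ae_shift (lam := lam) measurable_timeShift
      (measurePreserving_timeShift (P := P)) hU0] with p hp hpD
    filter_upwards [hp, hlam] with r hr hrδ hn
    refine hr ?_ ?_
    · refine not_le.1 fun h => hn ⟨⟨?_, h⟩, trivial⟩
      exact add_nonneg hpD.1.1 hrδ.1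
    · exact add_le_add hpD.1.2 hrδ.2

/-- The two-time duality between the delay operator with density `A`, acting in the smaller time,
and its advanced adjoint, in which both times are advanced. -/
theorem setIntegral_inner_delay_triangle (hA : IsDelayDensity ℱ T δ lam A)
    (hχ : StronglyMeasurable (fun p : ℝ × Ω => χ p.1 p.2))
    (h0 : ∀ᵐ t ∂(volume.restrict (Icc (-δ) 0)), ∀ᵐ ω ∂P, χ t ω = 0)
    (hsq : DelaySqIntegrable P T lam A χ)
    {V : ℝ → ℝ → Ω → H} (hV : StronglyMeasurable (fun p : ℝ × ℝ × Ω => V p.1 p.2.1 p.2.2))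
    (hV2 : MemLp (fun p : ℝ × ℝ × Ω => V p.2.1 p.1 p.2.2) 2
      ((volume.restrict (Icc 0 T)).prod ((volume.restrict (Icc 0 T)).prod P)))
    (hV0 : ∀ᵐ p ∂((volume : Measure ℝ).prod ((volume : Measure ℝ).prod P)),
      0 ≤ p.1 → p.1 ≤ p.2.1 → T < p.2.1 → p.2.1 ≤ T + δ → V p.2.1 p.1 p.2.2 = 0) :
    IntegrableOn (fun p : ℝ × ℝ × Ω => ∫ r, ContinuousLinearMap.adjoint (A (p.1 + r) p.2.2 r)
      (V (p.2.1 + r) (p.1 + r) p.2.2) ∂lam) (triangle Ω T)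
      ((volume : Measure ℝ).prod ((volume : Measure ℝ).prod P)) ∧
    IntegrableOn (fun p : ℝ × ℝ × Ω => ⟪χ p.1 p.2.2,
      ∫ r, ContinuousLinearMap.adjoint (A (p.1 + r) p.2.2 r)
      (V (p.2.1 + r) (p.1 + r) p.2.2) ∂lam⟫) (triangle Ω T)
      ((volume : Measure ℝ).prod ((volume : Measure ℝ).prod P)) ∧
    IntegrableOn (fun p : ℝ × ℝ × Ω => ⟪delayInt lam A χ p.1 p.2.2, V p.2.1 p.1 p.2.2⟫)
      (triangle Ω T) ((volume : Measure ℝ).prod ((volume : Measure ℝ).prod P)) ∧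
    ∫ p in triangle Ω T, ⟪χ p.1 p.2.2, ∫ r, ContinuousLinearMap.adjoint (A (p.1 + r) p.2.2 r)
      (V (p.2.1 + r) (p.1 + r) p.2.2) ∂lam⟫
      ∂((volume : Measure ℝ).prod ((volume : Measure ℝ).prod P))
      = ∫ p in triangle Ω T, ⟪delayInt lam A χ p.1 p.2.2, V p.2.1 p.1 p.2.2⟫
        ∂((volume : Measure ℝ).prod ((volume : Measure ℝ).prod P)) := by
  have := hA.prob
  obtain ⟨C, hC⟩ := hA.bounded
  have hlam : ∀ᵐ r ∂lam, r ∈ Icc 0 δ := by rw [ae_iff]; exact hA.support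
  have hD : MeasurableSet (triangle Ω T) := measurableSet_triangle T
  have htr := stronglyMeasurable_truncate T hχ
  set μ : Measure ℝ := volume.restrict (Icc 0 T) with hμ
  have hle := restrict_triangle_le (P := P) T
  have hac := hle.absolutelyContinuous
  have hsw := measurePreserving_swap_left (P := P) μ μ
  have hKq : Measure.QuasiMeasurePreserving (fun p : ℝ × ℝ × Ω => (p.1, p.2.2))
      (μ.prod (μ.prod P)) (μ.prod P) :=
    Measure.quasiMeasurePreserving_snd.comp hsw.quasiMeasurePreserving
  have hVs : StronglyMeasurable (fun p : ℝ × ℝ × Ω => V p.2.1 p.1 p.2.2) :=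
    hV.comp_measurable measurable_swap_left
  have hAm := measurable_lintegral_delay (lam := lam) hA hχ
  -- the delay integral, as a square integrable function on the triangle
  have hdel : MemLp (fun p : ℝ × ℝ × Ω => delayInt lam A χ p.1 p.2.2) 2
      (μ.prod (μ.prod P)) := by
    have h1 := (memLp_delayInt hA hχ hsq).comp_snd μ
    exact h1.comp_measurePreserving hsw
  have hpair : Integrable (fun p : ℝ × ℝ × Ω => ⟪delayInt lam A χ p.1 p.2.2, V p.2.1 p.1 p.2.2⟫)
      (μ.prod (μ.prod P)) := integrable_inner_of_memLp hdel hV2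
  have hKfin : ∫⁻ p : ℝ × ℝ × Ω, (∫⁻ r, ‖A p.1 p.2.2 r (χ (p.1 - r) p.2.2)‖ₑ ∂lam) ^ 2
      ∂(μ.prod (μ.prod P)) < ∞ := by
    have hAm2 : Measurable (fun p : ℝ × ℝ × Ω =>
        (∫⁻ r, ‖A p.2.1 p.2.2 r (χ (p.2.1 - r) p.2.2)‖ₑ ∂lam) ^ 2) :=
      (hAm.comp measurable_snd).pow_const 2
    have h1 := hsw.lintegral_comp hAm2
    simp only at h1
    rw [h1, lintegral_prod _ hAm2.aemeasurable]
    simp only [lintegral_const]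
    exact ENNReal.mul_lt_top hsq (measure_lt_top _ _)
  have hres := setIntegral_inner_delay (θ := timeShift₂)
    (ν := (volume : Measure ℝ).prod ((volume : Measure ℝ).prod P)) (lam := lam)
    (A := fun p r => A p.1 p.2.2 r) (V := fun p => V p.2.1 p.1 p.2.2) (D := triangle Ω T)
    (x := fun p => truncate T χ p.1 p.2.2) (x' := fun p => χ p.1 p.2.2)
    (y := fun p r => truncate T χ (p.1 - r) p.2.2) (y' := fun p r => χ (p.1 - r) p.2.2)
    measurable_timeShift₂ measurePreserving_timeShift₂ ?_ ?_ hVs hD ?_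
    (C := C) (fun p hp => hC p.1 ⟨hp.1, hp.2.1.trans hp.2.2⟩ p.2.2) ?_ ?_ ?_ ?_ ?_ ?_ ?_
  · exact ⟨hres.1, hres.2.1, hpair.mono_measure hle, hres.2.2⟩
  · intro p r; simp [timeShift₂]
  · exact hA.measurable.comp_measurable
      (g := fun p : (ℝ × ℝ × Ω) × ℝ => (p.1.1, p.1.2.2, p.2)) (by fun_prop)
  · exact htr.comp_measurable (g := fun p : (ℝ × ℝ × Ω) × ℝ => (p.1.1 - p.2, p.1.2.2))
      (by fun_prop)
  · exact (hV2.integrable one_le_two).mono_measure hle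
  · exact lt_of_le_of_lt (lintegral_mono' hle le_rfl)
      (lintegral_inner_lt_top (V := fun p : ℝ × ℝ × Ω => V p.2.1 p.1 p.2.2) hKfin hVs hV2)
  · exact hac.ae_le (hKq.ae (ae_integrable_delay hA hχ hsq))
  · have hne : ∀ᵐ p : ℝ × ℝ × Ω ∂((volume : Measure ℝ).prod ((volume : Measure ℝ).prod P)),
        p.1 ≠ 0 := Measure.quasiMeasurePreserving_fst.ae (Measure.ae_ne volume 0)
    rw [ae_restrict_iff' hD]
    filter_upwards [hne] with p hp hpD
    rw [truncate_of_mem χ ⟨lt_of_le_of_ne hpD.1 (Ne.symm hp), hpD.2.1.trans hpD.2.2⟩]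
  · rw [ae_restrict_iff' hD]
    filter_upwards [ae_swap_left (ae_truncate_sub (P := P) (T := T) hA.support hχ h0)]
      with p hp hpD
    exact hp ⟨hpD.1, hpD.2.1.trans hpD.2.2⟩
  · intro p hp
    by_cases h : p.1 ∈ Ioc 0 T
    -- the order of the two times is kept under a common shift, and the larger time increases
    · right
      filter_upwards [hlam] with r hr hn
      refine hp ⟨h.1.le, by simpa [timeShift₂] using hn.2.1, ?_⟩
      have : p.2.1 + r ≤ T := hn.2.2
      linarith [hr.1]
    · exact Or.inl (truncate_of_notMem χ h _)
  · rw [ae_restrict_iff' hD]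
    filter_upwards [ae_ae_shift (lam := lam) measurable_timeShift₂
      (measurePreserving_timeShift₂ (P := P)) hV0] with p hp hpD
    filter_upwards [hp, hlam] with r hr hrδ hn
    have e1 : 0 ≤ p.1 + r := add_nonneg hpD.1 hrδ.1
    have e2 : p.1 + r ≤ p.2.1 + r := add_le_add_left hpD.2.1 r
    exact hr e1 e2 (not_le.1 fun h => hn ⟨e1, e2, h⟩) (add_le_add hpD.2.2 hrδ.2)

end Delay

/-! ### Terminal values and the cost functional -/

section Equations

variable {Ω : Type*} {mΩ : MeasurableSpace Ω} {P : Measure Ω} [IsProbabilityMeasure P]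
  {n m d : ℕ} {T δ : ℝ} {W : Fin d → ℝ≥0 → Ω → ℝ} {hW : IsBrownianMotion W P}
  {D : LinearData Ω n m d} {Y : ℝ → Ω → Vec n} {Z : ℝ → ℝ → Ω → Mat n d} {χ : ℝ → Ω → Vec n}

/-- The terminal condition on `Y`, as a property of almost every `(t, ω)`. -/
theorem IsAdaptedMSolution.ae_Y_eq_zero
    (h : IsAdaptedMSolution W (brownianFiltration hW) P T δ D Y Z) :
    ∀ᵐ p ∂((volume : Measure ℝ).prod P), T < p.1 → p.1 ≤ T + δ → Y p.1 p.2 = 0 := by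
  rw [Measure.ae_prod_iff_ae_ae]
  · have h1 := h.terminal
    rw [ae_restrict_iff' measurableSet_Ioc] at h1
    filter_upwards [h1] with t ht
    by_cases htm : t ∈ Ioc T (T + δ)
    · exact (ht htm).mono fun ω h _ _ => h
    · exact ae_of_all _ fun ω h h' => absurd ⟨h, h'⟩ htm
  · have hA : MeasurableSet {p : ℝ × Ω | T < p.1} :=
      measurableSet_lt measurable_const measurable_fst
    have hB : MeasurableSet {p : ℝ × Ω | p.1 ≤ T + δ} :=
      measurableSet_le measurable_fst measurable_const
    exact hA.imp (hB.imp (h.mem.memY.measurable.measurableSet_eq_fun stronglyMeasurable_const))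

/-- After the terminal time `T` the process `Y` vanishes, hence by the isometry so does the
integrand `Z` that represents it. -/
theorem IsAdaptedMSolution.ae_Z_eq_zero (hT : 0 ≤ T)
    (h : IsAdaptedMSolution W (brownianFiltration hW) P T δ D Y Z) :
    ∀ᵐ p ∂((volume : Measure ℝ).prod ((volume : Measure ℝ).prod P)),
      0 ≤ p.1 → p.1 ≤ p.2.1 → T < p.2.1 → p.2.1 ≤ T + δ → Z p.2.1 p.1 p.2.2 = 0 := by
  have hm : MeasurableSet {p : ℝ × ℝ × Ω | 0 ≤ p.2.1 → p.2.1 ≤ p.1 → T < p.1 → p.1 ≤ T + δ →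
      Z p.1 p.2.1 p.2.2 = 0} := by
    have h1 : MeasurableSet {p : ℝ × ℝ × Ω | 0 ≤ p.2.1} :=
      measurableSet_le measurable_const (by fun_prop)
    have h2 : MeasurableSet {p : ℝ × ℝ × Ω | p.2.1 ≤ p.1} :=
      measurableSet_le (by fun_prop) (by fun_prop)
    have h3 : MeasurableSet {p : ℝ × ℝ × Ω | T < p.1} :=
      measurableSet_lt measurable_const (by fun_prop)
    have h4 : MeasurableSet {p : ℝ × ℝ × Ω | p.1 ≤ T + δ} :=
      measurableSet_le (by fun_prop) measurable_const
    exact h1.imp (h2.imp (h3.imp (h4.imp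
      (h.mem.measurableZ.measurableSet_eq_fun stronglyMeasurable_const))))
  have key : ∀ᵐ p ∂((volume : Measure ℝ).prod ((volume : Measure ℝ).prod P)),
      0 ≤ p.2.1 → p.2.1 ≤ p.1 → T < p.1 → p.1 ≤ T + δ → Z p.1 p.2.1 p.2.2 = 0 := by
    rw [Measure.ae_prod_iff_ae_ae hm]
    have h1 := h.terminal
    have h2 := h.mem.repr
    rw [ae_restrict_iff' measurableSet_Ioc] at h1
    rw [ae_restrict_iff' measurableSet_Icc] at h2
    filter_upwards [h1, h2] with t ht1 ht2
    by_cases htm : t ∈ Ioc T (T + δ)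
    · have hY0 := ht1 htm
      have hito := ht2 ⟨hT.trans htm.1.le, htm.2⟩
      have hiso := hito.integral_inner le_rfl hito
      have hmean : ∫ ω, Y t ω ∂P = 0 := by
        rw [integral_congr_ae hY0, integral_zero]
      have hl : ∫ ω, ⟪Y t ω - ∫ ω', Y t ω' ∂P, Y t ω - ∫ ω', Y t ω' ∂P⟫ ∂P = 0 := by
        refine integral_eq_zero_of_ae ?_
        filter_upwards [hY0] with ω hω
        simp [hω, hmean]
      rw [hl] at hiso
      have hz := (integral_eq_zero_iff_of_nonneg (fun p => real_inner_self_nonneg)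
        (integrable_inner_of_memLp hito.1 hito.1)).1 hiso.symm
      have hz' : ∀ᵐ p ∂(((volume : Measure ℝ).restrict (Icc 0 t)).prod P), Z t p.1 p.2 = 0 := by
        filter_upwards [hz] with p hp
        exact inner_self_eq_zero.1 hp
      rw [prod_restrict_left, ae_restrict_iff' (measurableSet_Icc.prod MeasurableSet.univ)] at hz'
      filter_upwards [hz'] with p hp a1 a2 _ _
      exact hp ⟨⟨a1, a2⟩, trivial⟩
    · exact ae_of_all _ fun p _ _ a3 a4 => absurd ⟨a3, a4⟩ htm
  exact (measurePreserving_swap_left (P := P) volume volume).quasiMeasurePreserving.ae key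

theorem adjoint_innerSL_apply_one {E : Type*} [NormedAddCommGroup E] [InnerProductSpace ℝ E]
    [CompleteSpace E] (x : E) : ContinuousLinearMap.adjoint (innerSL ℝ x) (1 : ℝ) = x := by
  refine ext_inner_right ℝ fun y => ?_
  rw [ContinuousLinearMap.adjoint_inner_left]
  simp

/-- A row vector density, as a density of linear functionals. This makes the cost functional a delay
term to which the duality of delay and advanced operators applies. -/
theorem IsDelayDensity.rowVector {ℱ : Filtration ℝ mΩ} {lam : Measure ℝ} {L : ℝ → Ω → ℝ → Vec n}
    (h : IsDelayDensity ℱ T δ lam L) :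
    IsDelayDensity ℱ T δ lam (fun t ω r => innerSL ℝ (L t ω r)) where
  prob := h.prob
  support := h.support
  measurable := (innerSL ℝ (E := Vec n)).continuous.comp_stronglyMeasurable h.measurable
  adapted t ht r := (innerSL ℝ (E := Vec n)).continuous.comp_stronglyMeasurable (h.adapted t ht r)
  bounded := by
    obtain ⟨C, hC⟩ := h.bounded
    refine ⟨C, fun t ht ω => ?_⟩
    refine (lintegral_congr fun r => ?_).trans_le (hC t ht ω)
    rw [enorm_eq_iff_norm_eq]
    exact innerSL_apply_norm ℝ _

/-- The cost functional as a pairing of the free term of the backward equation with `χ`. -/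
theorem costFunctional_eq (hT : 0 ≤ T) {ℱ : Filtration ℝ mΩ} (hL : IsDelayDensity ℱ T δ D.lam3 D.L)
    (hL0 : ∀ t, T < t → ∀ ω r, D.L t ω r = 0)
    (hχ : StronglyMeasurable (fun p : ℝ × Ω => χ p.1 p.2))
    (h0 : ∀ᵐ t ∂(volume.restrict (Icc (-δ) 0)), ∀ᵐ ω ∂P, χ t ω = 0) (hI : CostDefined P T D χ) :
    Integrable (fun p : ℝ × Ω => ⟪χ p.1 p.2, ∫ r, D.L (p.1 + r) p.2 r ∂D.lam3⟫)
      ((volume.restrict (Icc 0 T)).prod P) ∧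
    costFunctional P T D χ = ∫ p, ⟪χ p.1 p.2, ∫ r, D.L (p.1 + r) p.2 r ∂D.lam3⟫
      ∂((volume.restrict (Icc 0 T)).prod P) := by
  have := hL.prob
  have hLs := hL.rowVector
  -- pair the delay term with the constant `1`, cut off after `T`
  set U : ℝ → Ω → ℝ := fun t _ => (Iic T).indicator (fun _ => (1 : ℝ)) t with hUdef
  have hUm : StronglyMeasurable (fun p : ℝ × Ω => U p.1 p.2) := by
    have : StronglyMeasurable ((Iic T).indicator (fun _ => (1 : ℝ))) :=
      stronglyMeasurable_const.indicator measurableSet_Iic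
    exact this.comp_measurable measurable_fst
  have hU1 : ∀ {t : ℝ} (ω : Ω), t ≤ T → U t ω = 1 := fun {t} ω ht => by
    simp [hUdef, ht]
  have hU2 : ∀ {t : ℝ} (ω : Ω), T < t → U t ω = 0 := fun {t} ω ht => by
    simp [hUdef, ht]
  have hDm : MeasurableSet (Icc (0 : ℝ) T ×ˢ (univ : Set Ω)) :=
    measurableSet_Icc.prod MeasurableSet.univ
  have hQ : ∀ᵐ p ∂(((volume : Measure ℝ).restrict (Icc 0 T)).prod P), U p.1 p.2 = 1 := by
    rw [prod_restrict_left]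
    filter_upwards [ae_restrict_mem hDm] with p hp
    exact hU1 p.2 hp.1.2
  have hUi : Integrable (fun p : ℝ × Ω => U p.1 p.2) ((volume.restrict (Icc 0 T)).prod P) :=
    (integrable_const (1 : ℝ)).congr (hQ.mono fun p hp => hp.symm)
  have hLm : StronglyMeasurable (fun p : (ℝ × Ω) × ℝ =>
      ⟪D.L p.1.1 p.1.2 p.2, χ (p.1.1 - p.2) p.1.2⟫) := stronglyMeasurable_delay hLs hχ
  have hAχi : ∀ᵐ p ∂(((volume : Measure ℝ).restrict (Icc 0 T)).prod P),
      Integrable (fun r => innerSL ℝ (D.L p.1 p.2 r) (χ (p.1 - r) p.2)) D.lam3 := by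
    have hlm := measurable_lintegral_delay hLs hχ
    filter_upwards [ae_lt_top hlm hI.ne] with p hp
    exact ⟨(hLm.comp_measurable measurable_prodMk_left).aestronglyMeasurable, hp⟩
  have hadj : ∀ (t : ℝ) (ω : Ω) (r : ℝ), ContinuousLinearMap.adjoint (innerSL ℝ (D.L t ω r))
      (U t ω) = D.L t ω r := by
    intro t ω r
    rcases le_or_gt t T with ht | ht
    · rw [hU1 ω ht, adjoint_innerSL_apply_one]
    · rw [hU2 ω ht, map_zero, hL0 t ht]
  obtain ⟨-, c2, c3⟩ := setIntegral_inner_delay_time (P := P) hLs hχ h0 hUm hUi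
    (ae_of_all _ fun p hp _ => hU2 p.2 hp) (by
      refine lt_of_eq_of_lt (lintegral_congr_ae ?_) hI
      filter_upwards [hQ] with p hp
      simp [hp]) hAχi
  simp_rw [hadj] at c2 c3
  refine ⟨c2, ?_⟩
  rw [c3]
  have hint : Integrable (fun p : ℝ × Ω => ∫ r, ⟪D.L p.1 p.2 r, χ (p.1 - r) p.2⟫ ∂D.lam3)
      ((volume.restrict (Icc 0 T)).prod P) := by
    refine ⟨hLm.integral_prod_right'.aestronglyMeasurable, ?_⟩
    rw [hasFiniteIntegral_iff_enorm]
    exact lt_of_le_of_lt (lintegral_mono fun p => enorm_integral_le_lintegral_enorm _) hI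
  have e1 : ∫ p, ⟪delayInt D.lam3 (fun t ω r => innerSL ℝ (D.L t ω r)) χ p.1 p.2, U p.1 p.2⟫
      ∂((volume.restrict (Icc 0 T)).prod P)
      = ∫ p : ℝ × Ω, (∫ r, ⟪D.L p.1 p.2 r, χ (p.1 - r) p.2⟫ ∂D.lam3)
        ∂((volume.restrict (Icc 0 T)).prod P) := by
    refine integral_congr_ae ?_
    filter_upwards [hQ] with p hp
    simp [hp, delayInt]
  rw [e1, integral_prod_symm _ hint, costFunctional]
  simp_rw [intervalIntegral.integral_of_le hT, ← integral_Icc_eq_integral_Ioc]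

end Equations

/-! ### The duality relation -/

section Slices

variable {Ω : Type*} {mΩ : MeasurableSpace Ω} {P : Measure Ω} [SFinite P]

theorem ae_memLp_two_slice {E : Type*} [NormedAddCommGroup E] {μ : Measure ℝ} [SFinite μ]
    {f : ℝ × Ω → E} (hf : StronglyMeasurable f) (h : MemLp f 2 (μ.prod P)) :
    ∀ᵐ t ∂μ, MemLp (fun ω => f (t, ω)) 2 P := by
  filter_upwards [(h.integrable_norm_pow two_ne_zero).prod_right_ae] with t ht
  exact (memLp_two_iff_integrable_sq_norm
    (hf.comp_measurable measurable_prodMk_left).aestronglyMeasurable).2 ht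

theorem restrict_prod_mono {S R : Set ℝ} (h : S ⊆ R) :
    ((volume : Measure ℝ).restrict S).prod P ≤ ((volume : Measure ℝ).restrict R).prod P := by
  rw [prod_restrict_left, prod_restrict_left]
  exact Measure.restrict_mono (prod_mono_left h) le_rfl

theorem IsBoundedCoeff.memLp_apply {E F : Type*} [NormedAddCommGroup E] [NormedSpace ℝ E]
    [NormedAddCommGroup F] [NormedSpace ℝ F] {ℱ : Filtration ℝ mΩ} {T : ℝ}
    {A : ℝ → Ω → (E →L[ℝ] F)} (hA : IsBoundedCoeff ℱ T A) {v : ℝ → Ω → E}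
    (hv : MemL2F ℱ P 0 T v) :
    MemLp (fun p : ℝ × Ω => A p.1 p.2 (v p.1 p.2)) 2 ((volume.restrict (Icc 0 T)).prod P) := by
  obtain ⟨C, hC⟩ := hA.bounded
  refine MemLp.of_le_mul (c := C) hv.memLp ?_ ?_
  · exact (isBoundedBilinearMap_apply.continuous.comp_stronglyMeasurable
      (hA.measurable.prodMk hv.measurable)).aestronglyMeasurable
  · rw [prod_restrict_left, ae_restrict_iff' (measurableSet_Icc.prod MeasurableSet.univ)]
    refine ae_of_all _ fun p hp => ?_
    exact (A p.1 p.2).le_of_opNorm_le (hC p.1 hp.1 p.2) _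

end Slices

end NeutralSFDE

end

open NeutralSFDE

theorem proposition3p2 {Ω : Type*} {mΩ : MeasurableSpace Ω} {P : Measure Ω}
    [IsProbabilityMeasure P] {n m d : ℕ} {T δ : ℝ} (hT : 0 < T) (hδ : 0 ≤ δ)
    {W : Fin d → ℝ≥0 → Ω → ℝ} (hW : IsBrownianMotion W P)
    {D : LinearData Ω n m d} (hD : D.Admissible (brownianFiltration hW) T δ)
    {v : ℝ → Ω → Vec m} (hv : MemL2F (brownianFiltration hW) P 0 T v)
    {ρ : ℝ → Ω → Vec n} (hρ : IsControlForcing W (brownianFiltration hW) P T D v ρ)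
    {χ : ℝ → Ω → Vec n} (hχ : IsForwardSolution W (brownianFiltration hW) P T δ D v χ)
    (hI : CostDefined P T D χ)
    {Y : ℝ → Ω → Vec n} {Z : ℝ → ℝ → Ω → Mat n d}
    (hYZ : IsAdaptedMSolution W (brownianFiltration hW) P T δ D Y Z) :
    Integrable (fun p : ℝ × Ω => ⟪ρ p.1 p.2, Y p.1 p.2⟫) ((volume.restrict (Icc 0 T)).prod P) ∧
    costFunctional P T D χ = ∫ ω, (∫ t in (0 : ℝ)..T, ⟪ρ t ω, Y t ω⟫) ∂P := by
  have hTδ : T ≤ T + δ := by linarith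
  have hχm := hχ.mem.measurable
  have hYm := hYZ.mem.memY.measurable
  have hZm := hYZ.mem.measurableZ
  have hχ2 : MemLp (fun p : ℝ × Ω => χ p.1 p.2) 2 ((volume.restrict (Icc 0 T)).prod P) :=
    hχ.mem.memLp.mono_measure (restrict_prod_mono (Icc_subset_Icc (by linarith) le_rfl))
  have hY2 : MemLp (fun p : ℝ × Ω => Y p.1 p.2) 2 ((volume.restrict (Icc 0 T)).prod P) :=
    hYZ.mem.memY.memLp.mono_measure (restrict_prod_mono (Icc_subset_Icc le_rfl hTδ))
  have hZ2 : MemLp (fun p : ℝ × ℝ × Ω => Z p.2.1 p.1 p.2.2) 2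
      ((volume.restrict (Icc 0 T)).prod ((volume.restrict (Icc 0 T)).prod P)) := by
    have h1 : ((volume : Measure ℝ).restrict (Icc 0 T)).prod ((volume.restrict (Icc 0 T)).prod P)
        ≤ ((volume : Measure ℝ).restrict (Icc 0 (T + δ))).prod
          ((volume.restrict (Icc 0 (T + δ))).prod P) := by
      simp_rw [prod_restrict_left (P := P), Measure.prod_restrict]
      exact Measure.restrict_mono (prod_mono (Icc_subset_Icc le_rfl hTδ)
        (prod_mono_left (Icc_subset_Icc le_rfl hTδ))) le_rfl
    exact (hYZ.mem.memLpZ.mono_measure h1).comp_measurePreserving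
      (measurePreserving_swap_left (P := P) _ _)
  have hY0 := hYZ.ae_Y_eq_zero
  have hZ0 := hYZ.ae_Z_eq_zero hT.le
  -- the square integrable terms of the forward equation
  have hg2 := memLp_delayInt hD.densityG hχm hχ.sqG
  have hβ2 := memLp_delayInt hD.densityB hχm hχ.sqB
  have hσ2 := memLp_delayInt hD.densitySig hχm hχ.sqSig
  have hκ2 := hD.coeffb.memLp_apply hv
  have hc2 := hD.coeffs.memLp_apply hv
  have hgm : StronglyMeasurable (fun p : ℝ × Ω => delayInt D.lam0 D.G χ p.1 p.2) := by
    have := hD.densityG.prob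
    exact (stronglyMeasurable_delay hD.densityG hχm).integral_prod_right'
  have hgY := integrable_inner_of_memLp hg2 hY2
  have hχY := integrable_inner_of_memLp hχ2 hY2
  -- the duality relations for the four delay terms
  obtain ⟨L1, L2⟩ := costFunctional_eq hT.le hD.densityL hD.L_eq_zero hχm hχ.init hI
  obtain ⟨G1, G2, G3⟩ := setIntegral_inner_delay_time hD.densityG hχm hχ.init hYm
    (hY2.integrable one_le_two) hY0 (lintegral_inner_lt_top hχ.sqG hYm hY2)
    (ae_integrable_delay hD.densityG hχm hχ.sqG)
  obtain ⟨B1, B2, B3, B4⟩ := setIntegral_inner_delay_triangle (V := fun s _ ω => Y s ω)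
    hD.densityB hχm hχ.init hχ.sqB
    (hYm.comp_measurable (g := fun p : ℝ × ℝ × Ω => (p.1, p.2.2)) (by fun_prop))
    (hY2.comp_snd _)
    ((Measure.quasiMeasurePreserving_snd.ae hY0).mono fun p hp _ _ h3 h4 => hp h3 h4)
  obtain ⟨S1, S2, S3, S4⟩ := setIntegral_inner_delay_triangle (V := Z)
    hD.densitySig hχm hχ.init hχ.sqSig hZm hZ2 hZ0
  obtain ⟨FB1, -, -⟩ := integral_triangle B1
  obtain ⟨FB2, FBi, FBe⟩ := integral_triangle B2
  obtain ⟨FBi', FBe'⟩ := integral_triangle_symm B3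
  obtain ⟨FBn, -⟩ := integral_triangle_symm B3.norm
  obtain ⟨FS1, -, -⟩ := integral_triangle S1
  obtain ⟨FS2, FSi, FSe⟩ := integral_triangle S2
  obtain ⟨FSi', FSe'⟩ := integral_triangle_symm S3
  -- the backward equation, paired with `χ`
  have hback : ∀ᵐ t ∂(volume.restrict (Icc 0 T)), ∫ ω, ⟪χ t ω, Y t ω⟫ ∂P
      = ∫ ω, ⟪χ t ω, ∫ r, D.L (t + r) ω r ∂D.lam3⟫ ∂P + ∫ ω, ⟪χ t ω, backwardG D Y t ω⟫ ∂P
        + (∫ p : ℝ × Ω, ⟪χ t p.2, ∫ r, ContinuousLinearMap.adjoint (D.B (t + r) p.2 r)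
            (Y (p.1 + r) p.2) ∂D.lam1⟫ ∂((volume.restrict (Icc t T)).prod P)
          + ∫ p : ℝ × Ω, ⟪χ t p.2, ∫ r, ContinuousLinearMap.adjoint (D.Sig (t + r) p.2 r)
            (Z (p.1 + r) (t + r) p.2) ∂D.lam2⟫ ∂((volume.restrict (Icc t T)).prod P)) := by
    obtain ⟨η, hηm, hη, hito⟩ := hYZ.eq
    filter_upwards [hη, hito, ae_restrict_mem measurableSet_Icc, ae_memLp_two_slice hχm hχ2,
      ae_memLp_two_slice hYm hY2, L1.prod_right_ae, G1.prod_right_ae, G2.prod_right_ae, FB1, FB2,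
      FS1, FS2] with t h1 h2 ht h3 h4 h5 h6 h7 h8 h9 h10 h11
    have hadd : ∀ p : ℝ × Ω, ⟪χ t p.2, backwardF D Y Z t p.1 p.2⟫
        = ⟪χ t p.2, ∫ r, ContinuousLinearMap.adjoint (D.B (t + r) p.2 r)
            (Y (p.1 + r) p.2) ∂D.lam1⟫
          + ⟪χ t p.2, ∫ r, ContinuousLinearMap.adjoint (D.Sig (t + r) p.2 r)
            (Z (p.1 + r) (t + r) p.2) ∂D.lam2⟫ := fun p => inner_add_right _ _ _
    have hres := integral_inner_backward (hW := hW) ht.1 ht.2 (X := χ t) (Yt := Y t)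
      (g := backwardG D Y t) (f := backwardF D Y Z t) (η := η t)
      (hχ.mem.adapted t ⟨by linarith [ht.1], ht.2⟩) h3 h4 h5 h6 h7 (h8.add h10)
      ((h9.add h11).congr (ae_of_all _ fun p => (hadd p).symm))
      (hηm.comp_measurable (g := fun p : ℝ × Ω => (t, p)) (by fun_prop)) h1 h2
    rw [hres]
    simp_rw [hadd]
    rw [integral_add h9 h11]
  -- the forward equation, paired with `Y`
  have hforw : ∀ᵐ t ∂(volume.restrict (Icc 0 T)), Integrable (fun ω => ⟪ρ t ω, Y t ω⟫) P ∧
      ∫ ω, ⟪ρ t ω, Y t ω⟫ ∂P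
        = ∫ ω, ⟪χ t ω, Y t ω⟫ ∂P - ∫ ω, ⟪delayInt D.lam0 D.G χ t ω, Y t ω⟫ ∂P
        - ∫ p : ℝ × Ω, ⟪delayInt D.lam1 D.B χ p.1 p.2, Y t p.2⟫
          ∂((volume.restrict (Icc 0 t)).prod P)
        - ∫ p : ℝ × Ω, ⟪delayInt D.lam2 D.Sig χ p.1 p.2, Z t p.1 p.2⟫
          ∂((volume.restrict (Icc 0 t)).prod P) ∧
      ∫ ω, ‖⟪ρ t ω, Y t ω⟫‖ ∂P
        ≤ ∫ ω, ‖⟪χ t ω, Y t ω⟫‖ ∂P + ∫ ω, ‖⟪delayInt D.lam0 D.G χ t ω, Y t ω⟫‖ ∂P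
        + ∫ p : ℝ × Ω, ‖⟪delayInt D.lam1 D.B χ p.1 p.2, Y t p.2⟫‖
          ∂((volume.restrict (Icc 0 t)).prod P)
        + (∫ p : ℝ × Ω, ‖delayInt D.lam2 D.Sig χ p.1 p.2‖ ^ 2
            ∂((volume.restrict (Icc 0 T)).prod P) + ∫ ω, ‖Y t ω‖ ^ 2 ∂P) := by
    have hrepr : ∀ᵐ t ∂(volume.restrict (Icc 0 T)),
        IsItoIntegral W (brownianFiltration hW) P 0 t (Z t) (fun ω => Y t ω - ∫ ω', Y t ω' ∂P) :=
      ae_mono (Measure.restrict_mono (Icc_subset_Icc le_rfl hTδ) le_rfl) hYZ.mem.repr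
    filter_upwards [hχ.eq, hrepr, ae_restrict_mem measurableSet_Icc, ae_memLp_two_slice hχm hχ2,
      ae_memLp_two_slice hYm hY2, ae_memLp_two_slice hgm hg2] with t h1 h2 ht h3 h4 h5
    have hle : ((volume : Measure ℝ).restrict (Icc 0 t)).prod P
        ≤ ((volume : Measure ℝ).restrict (Icc 0 T)).prod P :=
      restrict_prod_mono (Icc_subset_Icc le_rfl ht.2)
    obtain ⟨r1, r2, r3⟩ := integral_inner_forward ht.1 h3 h4 h5 (hβ2.mono_measure hle)
      (hκ2.mono_measure hle) (hσ2.mono_measure hle) (hc2.mono_measure hle) h1 (hρ.eq t ht) h2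
    refine ⟨r1, r2, r3.trans ?_⟩
    gcongr
    exact ae_of_all _ fun p => by positivity
    exact hσ2.integrable_norm_pow two_ne_zero
  -- joint integrability of `⟪ρ, Y⟫`, from the bound on its slices
  have hρY : Integrable (fun p : ℝ × Ω => ⟪ρ p.1 p.2, Y p.1 p.2⟫)
      ((volume.restrict (Icc 0 T)).prod P) := by
    have hm : StronglyMeasurable (fun p : ℝ × Ω => ⟪ρ p.1 p.2, Y p.1 p.2⟫) :=
      hρ.measurable.inner hYm
    rw [integrable_prod_iff hm.aestronglyMeasurable]
    refine ⟨hforw.mono fun t h => h.1, ?_⟩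
    refine Integrable.mono' (((hχY.integral_norm_prod_left.add hgY.integral_norm_prod_left).add
      FBn).add ((integrable_const (∫ p : ℝ × Ω, ‖delayInt D.lam2 D.Sig χ p.1 p.2‖ ^ 2
        ∂((volume.restrict (Icc 0 T)).prod P))).add
        (hY2.integrable_norm_pow two_ne_zero).integral_prod_left))
      hm.norm.integral_prod_right'.aestronglyMeasurable ?_
    filter_upwards [hforw] with t h
    rw [Real.norm_of_nonneg (integral_nonneg fun ω => norm_nonneg _)]
    exact h.2.2
  refine ⟨hρY, ?_⟩
  -- eliminate `E⟪χ t, Y t⟫` between the two equations; after integration in `t` the delay terms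
  -- cancel in pairs
  have hR : ∫ ω, (∫ t in (0 : ℝ)..T, ⟪ρ t ω, Y t ω⟫) ∂P
      = ∫ t in Icc 0 T, ∫ ω, ⟪ρ t ω, Y t ω⟫ ∂P := by
    simp_rw [intervalIntegral.integral_of_le hT.le, ← integral_Icc_eq_integral_Ioc]
    rw [← integral_prod_symm _ hρY, integral_prod _ hρY]
  have i1 := L1.integral_prod_left
  have i2 := G2.integral_prod_left
  have i3 := hgY.integral_prod_left
  have hsum : ∀ᵐ t ∂(volume.restrict (Icc 0 T)), ∫ ω, ⟪ρ t ω, Y t ω⟫ ∂P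
      = ((∫ ω, ⟪χ t ω, ∫ r, D.L (t + r) ω r ∂D.lam3⟫ ∂P
        + (∫ ω, ⟪χ t ω, backwardG D Y t ω⟫ ∂P
          - ∫ ω, ⟪delayInt D.lam0 D.G χ t ω, Y t ω⟫ ∂P))
        + (∫ p : ℝ × Ω, ⟪χ t p.2, ∫ r, ContinuousLinearMap.adjoint (D.B (t + r) p.2 r)
            (Y (p.1 + r) p.2) ∂D.lam1⟫ ∂((volume.restrict (Icc t T)).prod P)
          - ∫ p : ℝ × Ω, ⟪delayInt D.lam1 D.B χ p.1 p.2, Y t p.2⟫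
            ∂((volume.restrict (Icc 0 t)).prod P)))
        + (∫ p : ℝ × Ω, ⟪χ t p.2, ∫ r, ContinuousLinearMap.adjoint (D.Sig (t + r) p.2 r)
            (Z (p.1 + r) (t + r) p.2) ∂D.lam2⟫ ∂((volume.restrict (Icc t T)).prod P)
          - ∫ p : ℝ × Ω, ⟪delayInt D.lam2 D.Sig χ p.1 p.2, Z t p.1 p.2⟫
            ∂((volume.restrict (Icc 0 t)).prod P)) := by
    filter_upwards [hback, hforw] with t h1 h2
    rw [h2.2.1, h1]
    ring
  have j2 := i2.sub i3
  have j3 := FBi.sub FBi'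
  have j4 := FSi.sub FSi'
  rw [integral_prod _ G2, integral_prod _ hgY] at G3
  rw [FBe, FBe'] at B4
  rw [FSe, FSe'] at S4
  have key : ∫ t in Icc 0 T, ∫ ω, ⟪ρ t ω, Y t ω⟫ ∂P
      = ∫ t in Icc 0 T, ∫ ω, ⟪χ t ω, ∫ r, D.L (t + r) ω r ∂D.lam3⟫ ∂P := by
    rw [integral_congr_ae hsum]
    refine (integral_add ((i1.add j2).add j3) j4).trans ?_
    rw [integral_add' (i1.add j2) j3, integral_add' i1 j2, integral_sub' i2 i3,
      integral_sub' FBi FBi', integral_sub' FSi FSi']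
    linarith
  rw [L2, hR, key, integral_prod _ L1]
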